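/- Let $\mathsf F^\mu$ be the call-by-value $\lambda$-calculus with types $$\tau ::= \alpha \mid \mathsf{unit} \mid \mathsf{int} \mid \mathsf{bool} \mid \tau_1\times\tau_2 \mid \tau_1+\tau_2 \mid \tau_1\to\tau_2 \mid \forall\alpha.\tau \mid \exists\alpha.\tau \mid \mu\alpha.\tau$$ (impredicative polymorphism and iso-recursive types, with the explicit term constructors $\mathsf{fold}$ and $\mathsf{unfold}$), whose terms include integer literals and primitive operations ($+,-,\times,=,<,\le$ on integers), booleans and conditionals, pairs, annotated sum injections and case analysis, annotated $\lambda$-abstractions, type abstraction and application, and $\mathsf{pack}$/$\mathsf{unpack}$. It has the standard typing judgment $\Gamma\vdash e:\tau$ and the standard left-to-right small-step reduction $\leadsto$. Write $e\Downarrow$ if $e\leadsto^* v$ for some value $v$. A program context $C$ is a term with a single hole, which may stand under binders; $\vdash C:(\Gamma\vdash\tau)\rightsquigarrow(\Gamma'\vdash\tau')$ is the usual typing judgment for contexts, where a hole of type $(\Gamma\vdash\tau)$ may be used in any context $\Gamma'\supseteq\Gamma$. For $\Gamma\vdash e_1:\tau$ and $\Gamma\vdash e_2:\tau$, contextual approximation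 $\Gamma\vdash e_1\preceq^{ctx}e_2:\tau$ means that for all $C,\tau'$ with $\vdash C:(\Gamma\vdash\tau)\rightsquigarrow(\cdot\vdash\tau')$, if $C[e_1]\Downarrow$ then $C[e_2]\Downarrow$. Contextual equivalence $\Gamma\vdash e_1\approx^{ctx}e_2:\tau$ means approximation in both directions. Recursive functions of type $\tau_1\to\tau_2$ are encoded by $$\mathsf{fix}\,f(x).e \;=\; \lambda y.\,(\mathsf{unfold}\,w)\,w\,y,\qquad w=\mathsf{fold}\bigl(\lambda z.\,(\lambda f.\lambda x.e)\,(\lambda y.\,(\mathsf{unfold}\,z)\,z\,y)\bigr),\quad y,z\notin \mathrm{FV}(e),$$ where $w$ and $z$ have type $\mu\beta.\,\beta\to(\tau_1\to\tau_2)$ with $\beta$ not free in $\tau_1,\tau_2$. **Theorem (syntactic minimal invariance).** Let $\tau=\mu\alpha.\,\mathsf{unit}+(\alpha\to\alpha)$, let $\mathsf{id}=\lambda x{:}\tau.\,x$, and let $$v=\mathsf{fix}\,f(x{:}\tau).\ \mathsf{case}\ (\mathsf{unfold}\,x)\ \mathsf{of}\ \mathsf{inl}\,\_\Rightarrow\mathsf{fold}(\mathsf{inl}\,\langle\rangle)\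 \mid\ \mathsf{inr}\,g\Rightarrow\mathsf{fold}\bigl(\mathsf{inr}(\lambda y{:}\tau.\,f(g(f\,y)))\bigr).$$ Then $\mathsf{id}$ and $v$ are well-typed closed terms of type $\tau\to\tau$ and $\cdot\vdash \mathsf{id}\approx^{ctx}v:\tau\to\tau$. -/

import Mathlib

namespace FMu

/-! ### Types

Syntax is well scoped and de Bruijn: `Ty n` is the set of types, up to renaming of bound variables,
whose free type variables are among `n` given ones, so the judgment that a type is well formed in
a context holds by construction. -/

/-- Types with `n` free type variables. -/
inductive Ty : ℕ → Type
  | var {n : ℕ} (i : Fin n) : Ty n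
  | unit {n : ℕ} : Ty n
  | int {n : ℕ} : Ty n
  | bool {n : ℕ} : Ty n
  | prod {n : ℕ} (τ₁ τ₂ : Ty n) : Ty n
  | sum {n : ℕ} (τ₁ τ₂ : Ty n) : Ty n
  | arr {n : ℕ} (τ₁ τ₂ : Ty n) : Ty n
  | all {n : ℕ} (τ : Ty (n + 1)) : Ty n
  | ex {n : ℕ} (τ : Ty (n + 1)) : Ty n
  | mu {n : ℕ} (τ : Ty (n + 1)) : Ty n

/-- A renaming pushed under one binder. -/
def liftRen {n n' : ℕ} (ξ : Fin n → Fin n') : Fin (n + 1) → Fin (n' + 1) :=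
  Fin.cases 0 (fun i => (ξ i).succ)

/-- Renaming of type variables in a type. -/
def Ty.rename : {n n' : ℕ} → (Fin n → Fin n') → Ty n → Ty n'
  | _, _, ξ, .var i => .var (ξ i)
  | _, _, _, .unit => .unit
  | _, _, _, .int => .int
  | _, _, _, .bool => .bool
  | _, _, ξ, .prod τ₁ τ₂ => .prod (τ₁.rename ξ) (τ₂.rename ξ)
  | _, _, ξ, .sum τ₁ τ₂ => .sum (τ₁.rename ξ) (τ₂.rename ξ)
  | _, _, ξ, .arr τ₁ τ₂ => .arr (τ₁.rename ξ) (τ₂.rename ξ)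
  | _, _, ξ, .all τ => .all (τ.rename (liftRen ξ))
  | _, _, ξ, .ex τ => .ex (τ.rename (liftRen ξ))
  | _, _, ξ, .mu τ => .mu (τ.rename (liftRen ξ))

/-- A type substitution pushed under one type binder. -/
def Ty.liftSub {n n' : ℕ} (θ : Fin n → Ty n') : Fin (n + 1) → Ty (n' + 1) :=
  Fin.cases (.var 0) (fun i => (θ i).rename Fin.succ)

/-- Simultaneous capture-avoiding substitution of types for the type variables of a type. -/
def Ty.subst : {n n' : ℕ} → (Fin n → Ty n') → Ty n → Ty n'
  | _, _, θ, .var i => θ i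
  | _, _, _, .unit => .unit
  | _, _, _, .int => .int
  | _, _, _, .bool => .bool
  | _, _, θ, .prod τ₁ τ₂ => .prod (τ₁.subst θ) (τ₂.subst θ)
  | _, _, θ, .sum τ₁ τ₂ => .sum (τ₁.subst θ) (τ₂.subst θ)
  | _, _, θ, .arr τ₁ τ₂ => .arr (τ₁.subst θ) (τ₂.subst θ)
  | _, _, θ, .all τ => .all (τ.subst (Ty.liftSub θ))
  | _, _, θ, .ex τ => .ex (τ.subst (Ty.liftSub θ))
  | _, _, θ, .mu τ => .mu (τ.subst (Ty.liftSub θ))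

/-- `τ.inst τ₁` is `τ[τ₁/α]`, where `α` is the last bound type variable. -/
def Ty.inst {n : ℕ} (τ : Ty (n + 1)) (τ₁ : Ty n) : Ty n :=
  τ.subst (Fin.cases τ₁ Ty.var)

/-! ### Terms -/

/-- Primitive operations on integers. -/
inductive PrimOp : Type
  | add
  | sub
  | mul
  | eq
  | lt
  | le

/-- Result type of a primitive operation (both arguments are integers). -/
def PrimOp.resTy {n : ℕ} : PrimOp → Ty n
  | .add => .int
  | .sub => .int
  | .mul => .int
  | .eq => .bool
  | .lt => .bool
  | .le => .bool

/-- Terms with `n` free type variables and `m` free term variables. Variable `0` is the innermost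
one. In `caseOf` each branch binds a term variable; `unpack` binds one type variable and one term
variable in its body. -/
inductive Tm : ℕ → ℕ → Type
  | var {n m : ℕ} (i : Fin m) : Tm n m
  | unit {n m : ℕ} : Tm n m
  | int {n m : ℕ} (k : ℤ) : Tm n m
  | prim {n m : ℕ} (o : PrimOp) (e₁ e₂ : Tm n m) : Tm n m
  | tt {n m : ℕ} : Tm n m
  | ff {n m : ℕ} : Tm n m
  | cond {n m : ℕ} (e e₁ e₂ : Tm n m) : Tm n m
  | pair {n m : ℕ} (e₁ e₂ : Tm n m) : Tm n m
  | fst {n m : ℕ} (e : Tm n m) : Tm n m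
  | snd {n m : ℕ} (e : Tm n m) : Tm n m
  | inl {n m : ℕ} (τ : Ty n) (e : Tm n m) : Tm n m
  | inr {n m : ℕ} (τ : Ty n) (e : Tm n m) : Tm n m
  | caseOf {n m : ℕ} (e : Tm n m) (e₁ e₂ : Tm n (m + 1)) : Tm n m
  | lam {n m : ℕ} (τ : Ty n) (e : Tm n (m + 1)) : Tm n m
  | app {n m : ℕ} (e₁ e₂ : Tm n m) : Tm n m
  | tlam {n m : ℕ} (e : Tm (n + 1) m) : Tm n m
  | tapp {n m : ℕ} (e : Tm n m) (τ : Ty n) : Tm n m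
  /-- `pack τ₁, e as ∃α.τ`. -/
  | pack {n m : ℕ} (τ₁ : Ty n) (e : Tm n m) (τ : Ty (n + 1)) : Tm n m
  | unpack {n m : ℕ} (e₁ : Tm n m) (e₂ : Tm (n + 1) (m + 1)) : Tm n m
  | fold {n m : ℕ} (τ : Ty n) (e : Tm n m) : Tm n m
  | unfold {n m : ℕ} (e : Tm n m) : Tm n m

/-- The outcome of a primitive operation, as a literal. -/
def PrimOp.eval {n m : ℕ} : PrimOp → ℤ → ℤ → Tm n m
  | .add, a, b => .int (a + b)
  | .sub, a, b => .int (a - b)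
  | .mul, a, b => .int (a * b)
  | .eq, a, b => if a = b then .tt else .ff
  | .lt, a, b => if a < b then .tt else .ff
  | .le, a, b => if a ≤ b then .tt else .ff

/-- Renaming of the type variables (by `ξ`) and term variables (by `ρ`) of a term. -/
def Tm.rename : {n n' m m' : ℕ} → (Fin n → Fin n') → (Fin m → Fin m') → Tm n m → Tm n' m'
  | _, _, _, _, _, ρ, .var i => .var (ρ i)
  | _, _, _, _, _, _, .unit => .unit
  | _, _, _, _, _, _, .int k => .int k
  | _, _, _, _, ξ, ρ, .prim o e₁ e₂ => .prim o (e₁.rename ξ ρ) (e₂.rename ξ ρ)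
  | _, _, _, _, _, _, .tt => .tt
  | _, _, _, _, _, _, .ff => .ff
  | _, _, _, _, ξ, ρ, .cond e e₁ e₂ => .cond (e.rename ξ ρ) (e₁.rename ξ ρ) (e₂.rename ξ ρ)
  | _, _, _, _, ξ, ρ, .pair e₁ e₂ => .pair (e₁.rename ξ ρ) (e₂.rename ξ ρ)
  | _, _, _, _, ξ, ρ, .fst e => .fst (e.rename ξ ρ)
  | _, _, _, _, ξ, ρ, .snd e => .snd (e.rename ξ ρ)
  | _, _, _, _, ξ, ρ, .inl τ e => .inl (τ.rename ξ) (e.rename ξ ρ)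
  | _, _, _, _, ξ, ρ, .inr τ e => .inr (τ.rename ξ) (e.rename ξ ρ)
  | _, _, _, _, ξ, ρ, .caseOf e e₁ e₂ =>
      .caseOf (e.rename ξ ρ) (e₁.rename ξ (liftRen ρ)) (e₂.rename ξ (liftRen ρ))
  | _, _, _, _, ξ, ρ, .lam τ e => .lam (τ.rename ξ) (e.rename ξ (liftRen ρ))
  | _, _, _, _, ξ, ρ, .app e₁ e₂ => .app (e₁.rename ξ ρ) (e₂.rename ξ ρ)
  | _, _, _, _, ξ, ρ, .tlam e => .tlam (e.rename (liftRen ξ) ρ)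
  | _, _, _, _, ξ, ρ, .tapp e τ => .tapp (e.rename ξ ρ) (τ.rename ξ)
  | _, _, _, _, ξ, ρ, .pack τ₁ e τ =>
      .pack (τ₁.rename ξ) (e.rename ξ ρ) (τ.rename (liftRen ξ))
  | _, _, _, _, ξ, ρ, .unpack e₁ e₂ =>
      .unpack (e₁.rename ξ ρ) (e₂.rename (liftRen ξ) (liftRen ρ))
  | _, _, _, _, ξ, ρ, .fold τ e => .fold (τ.rename ξ) (e.rename ξ ρ)
  | _, _, _, _, ξ, ρ, .unfold e => .unfold (e.rename ξ ρ)

/-- A term substitution pushed under one term binder. -/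
def Tm.liftSub {n m m' : ℕ} (σ : Fin m → Tm n m') : Fin (m + 1) → Tm n (m' + 1) :=
  Fin.cases (.var 0) (fun i => (σ i).rename id Fin.succ)

/-- A term substitution pushed under one type binder. -/
def Tm.liftTySub {n m m' : ℕ} (σ : Fin m → Tm n m') : Fin m → Tm (n + 1) m' :=
  fun i => (σ i).rename Fin.succ id

/-- Simultaneous capture-avoiding substitution of types (by `θ`) and terms (by `σ`) in a term. -/
def Tm.subst : {n n' m m' : ℕ} → (Fin n → Ty n') → (Fin m → Tm n' m') → Tm n m → Tm n' m'
  | _, _, _, _, _, σ, .var i => σ i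
  | _, _, _, _, _, _, .unit => .unit
  | _, _, _, _, _, _, .int k => .int k
  | _, _, _, _, θ, σ, .prim o e₁ e₂ => .prim o (e₁.subst θ σ) (e₂.subst θ σ)
  | _, _, _, _, _, _, .tt => .tt
  | _, _, _, _, _, _, .ff => .ff
  | _, _, _, _, θ, σ, .cond e e₁ e₂ => .cond (e.subst θ σ) (e₁.subst θ σ) (e₂.subst θ σ)
  | _, _, _, _, θ, σ, .pair e₁ e₂ => .pair (e₁.subst θ σ) (e₂.subst θ σ)
  | _, _, _, _, θ, σ, .fst e => .fst (e.subst θ σ)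
  | _, _, _, _, θ, σ, .snd e => .snd (e.subst θ σ)
  | _, _, _, _, θ, σ, .inl τ e => .inl (τ.subst θ) (e.subst θ σ)
  | _, _, _, _, θ, σ, .inr τ e => .inr (τ.subst θ) (e.subst θ σ)
  | _, _, _, _, θ, σ, .caseOf e e₁ e₂ =>
      .caseOf (e.subst θ σ) (e₁.subst θ (Tm.liftSub σ)) (e₂.subst θ (Tm.liftSub σ))
  | _, _, _, _, θ, σ, .lam τ e => .lam (τ.subst θ) (e.subst θ (Tm.liftSub σ))
  | _, _, _, _, θ, σ, .app e₁ e₂ => .app (e₁.subst θ σ) (e₂.subst θ σ)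
  | _, _, _, _, θ, σ, .tlam e => .tlam (e.subst (Ty.liftSub θ) (Tm.liftTySub σ))
  | _, _, _, _, θ, σ, .tapp e τ => .tapp (e.subst θ σ) (τ.subst θ)
  | _, _, _, _, θ, σ, .pack τ₁ e τ =>
      .pack (τ₁.subst θ) (e.subst θ σ) (τ.subst (Ty.liftSub θ))
  | _, _, _, _, θ, σ, .unpack e₁ e₂ =>
      .unpack (e₁.subst θ σ) (e₂.subst (Ty.liftSub θ) (Tm.liftSub (Tm.liftTySub σ)))
  | _, _, _, _, θ, σ, .fold τ e => .fold (τ.subst θ) (e.subst θ σ)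
  | _, _, _, _, θ, σ, .unfold e => .unfold (e.subst θ σ)

/-- `e[v/x]`. -/
def Tm.instTm {n m : ℕ} (e : Tm n (m + 1)) (v : Tm n m) : Tm n m :=
  e.subst Ty.var (Fin.cases v Tm.var)

/-- `e[τ/α]`. -/
def Tm.instTy {n m : ℕ} (e : Tm (n + 1) m) (τ : Ty n) : Tm n m :=
  e.subst (Fin.cases τ Ty.var) Tm.var

/-- `e[v/x][τ/α]` for `v` not containing `α`, as one simultaneous substitution. -/
def Tm.instTyTm {n m : ℕ} (e : Tm (n + 1) (m + 1)) (τ : Ty n) (v : Tm n m) : Tm n m :=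
  e.subst (Fin.cases τ Ty.var) (Fin.cases v Tm.var)

/-! ### Dynamic semantics: left-to-right call by value -/

/-- Values. -/
inductive IsValue : {n m : ℕ} → Tm n m → Prop
  | var {n m : ℕ} (i : Fin m) : IsValue (Tm.var i : Tm n m)
  | unit {n m : ℕ} : IsValue (Tm.unit : Tm n m)
  | int {n m : ℕ} (k : ℤ) : IsValue (Tm.int k : Tm n m)
  | tt {n m : ℕ} : IsValue (Tm.tt : Tm n m)
  | ff {n m : ℕ} : IsValue (Tm.ff : Tm n m)
  | pair {n m : ℕ} {v₁ v₂ : Tm n m} : IsValue v₁ → IsValue v₂ → IsValue (.pair v₁ v₂)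
  | inl {n m : ℕ} {τ : Ty n} {v : Tm n m} : IsValue v → IsValue (.inl τ v)
  | inr {n m : ℕ} {τ : Ty n} {v : Tm n m} : IsValue v → IsValue (.inr τ v)
  | lam {n m : ℕ} (τ : Ty n) (e : Tm n (m + 1)) : IsValue (.lam τ e)
  | tlam {n m : ℕ} (e : Tm (n + 1) m) : IsValue (.tlam e)
  | pack {n m : ℕ} {τ₁ : Ty n} {v : Tm n m} {τ : Ty (n + 1)} :
      IsValue v → IsValue (.pack τ₁ v τ)
  | fold {n m : ℕ} {τ : Ty n} {v : Tm n m} : IsValue v → IsValue (.fold τ v)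

/-- Evaluation contexts. -/
inductive ECtx (n m : ℕ) : Type
  | hole : ECtx n m
  | primL (o : PrimOp) (E : ECtx n m) (e₂ : Tm n m) : ECtx n m
  | primR (o : PrimOp) (v₁ : Tm n m) (hv : IsValue v₁) (E : ECtx n m) : ECtx n m
  | cond (E : ECtx n m) (e₁ e₂ : Tm n m) : ECtx n m
  | pairL (E : ECtx n m) (e₂ : Tm n m) : ECtx n m
  | pairR (v₁ : Tm n m) (hv : IsValue v₁) (E : ECtx n m) : ECtx n m
  | fst (E : ECtx n m) : ECtx n m
  | snd (E : ECtx n m) : ECtx n m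
  | inl (τ : Ty n) (E : ECtx n m) : ECtx n m
  | inr (τ : Ty n) (E : ECtx n m) : ECtx n m
  | caseOf (E : ECtx n m) (e₁ e₂ : Tm n (m + 1)) : ECtx n m
  | appL (E : ECtx n m) (e₂ : Tm n m) : ECtx n m
  | appR (v₁ : Tm n m) (hv : IsValue v₁) (E : ECtx n m) : ECtx n m
  | tapp (E : ECtx n m) (τ : Ty n) : ECtx n m
  | pack (τ₁ : Ty n) (E : ECtx n m) (τ : Ty (n + 1)) : ECtx n m
  | unpack (E : ECtx n m) (e₂ : Tm (n + 1) (m + 1)) : ECtx n m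
  | fold (τ : Ty n) (E : ECtx n m) : ECtx n m
  | unfold (E : ECtx n m) : ECtx n m

/-- `E.fill e` is `E[e]`. -/
def ECtx.fill {n m : ℕ} : ECtx n m → Tm n m → Tm n m
  | .hole, e => e
  | .primL o E e₂, e => .prim o (E.fill e) e₂
  | .primR o v₁ _ E, e => .prim o v₁ (E.fill e)
  | .cond E e₁ e₂, e => .cond (E.fill e) e₁ e₂
  | .pairL E e₂, e => .pair (E.fill e) e₂
  | .pairR v₁ _ E, e => .pair v₁ (E.fill e)
  | .fst E, e => .fst (E.fill e)
  | .snd E, e => .snd (E.fill e)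
  | .inl τ E, e => .inl τ (E.fill e)
  | .inr τ E, e => .inr τ (E.fill e)
  | .caseOf E e₁ e₂, e => .caseOf (E.fill e) e₁ e₂
  | .appL E e₂, e => .app (E.fill e) e₂
  | .appR v₁ _ E, e => .app v₁ (E.fill e)
  | .tapp E τ, e => .tapp (E.fill e) τ
  | .pack τ₁ E τ, e => .pack τ₁ (E.fill e) τ
  | .unpack E e₂, e => .unpack (E.fill e) e₂
  | .fold τ E, e => .fold τ (E.fill e)
  | .unfold E, e => .unfold (E.fill e)

/-- One reduction step. -/
inductive Step : {n m : ℕ} → Tm n m → Tm n m → Prop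
  | prim {n m : ℕ} (o : PrimOp) (a b : ℤ) :
      Step (.prim o (.int a) (.int b) : Tm n m) (o.eval a b)
  | condTrue {n m : ℕ} (e₁ e₂ : Tm n m) : Step (.cond .tt e₁ e₂) e₁
  | condFalse {n m : ℕ} (e₁ e₂ : Tm n m) : Step (.cond .ff e₁ e₂) e₂
  | fst {n m : ℕ} {v₁ v₂ : Tm n m} : IsValue v₁ → IsValue v₂ → Step (.fst (.pair v₁ v₂)) v₁
  | snd {n m : ℕ} {v₁ v₂ : Tm n m} : IsValue v₁ → IsValue v₂ → Step (.snd (.pair v₁ v₂)) v₂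
  | caseInl {n m : ℕ} {τ : Ty n} {v : Tm n m} {e₁ e₂ : Tm n (m + 1)} :
      IsValue v → Step (.caseOf (.inl τ v) e₁ e₂) (e₁.instTm v)
  | caseInr {n m : ℕ} {τ : Ty n} {v : Tm n m} {e₁ e₂ : Tm n (m + 1)} :
      IsValue v → Step (.caseOf (.inr τ v) e₁ e₂) (e₂.instTm v)
  | beta {n m : ℕ} {τ : Ty n} {e : Tm n (m + 1)} {v : Tm n m} :
      IsValue v → Step (.app (.lam τ e) v) (e.instTm v)
  | tbeta {n m : ℕ} (e : Tm (n + 1) m) (τ : Ty n) : Step (.tapp (.tlam e) τ) (e.instTy τ)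
  | unpack {n m : ℕ} {τ₁ : Ty n} {v : Tm n m} {τ : Ty (n + 1)} {e : Tm (n + 1) (m + 1)} :
      IsValue v → Step (.unpack (.pack τ₁ v τ) e) (e.instTyTm τ₁ v)
  | unfold {n m : ℕ} {τ : Ty n} {v : Tm n m} :
      IsValue v → Step (.unfold (.fold τ v)) v
  | ctx {n m : ℕ} (E : ECtx n m) {e e' : Tm n m} : Step e e' → Step (E.fill e) (E.fill e')

/-- `e ⇓`: evaluation of `e` reaches a value. -/
def Terminates {n m : ℕ} (e : Tm n m) : Prop :=
  ∃ v : Tm n m, Relation.ReflTransGen Step e v ∧ IsValue v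

/-! ### Static semantics -/

/-- Typing contexts with `n` type variables and `m` typed term variables. -/
abbrev TCtx (n m : ℕ) : Type := Fin m → Ty n

/-- The empty context. -/
def TCtx.empty : TCtx 0 0 := fun i => i.elim0

/-- `Γ, x : τ`. -/
def TCtx.extend {n m : ℕ} (Γ : TCtx n m) (τ : Ty n) : TCtx n (m + 1) :=
  Fin.cases τ Γ

/-- `Γ, α`. -/
def TCtx.extendTy {n m : ℕ} (Γ : TCtx n m) : TCtx (n + 1) m :=
  fun i => (Γ i).rename Fin.succ

/-- The typing judgment `Γ ⊢ e : τ`. -/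
inductive HasType : {n m : ℕ} → TCtx n m → Tm n m → Ty n → Prop
  | var {n m : ℕ} {Γ : TCtx n m} (i : Fin m) : HasType Γ (.var i) (Γ i)
  | unit {n m : ℕ} {Γ : TCtx n m} : HasType Γ .unit .unit
  | int {n m : ℕ} {Γ : TCtx n m} (k : ℤ) : HasType Γ (.int k) .int
  | prim {n m : ℕ} {Γ : TCtx n m} (o : PrimOp) {e₁ e₂ : Tm n m} :
      HasType Γ e₁ .int → HasType Γ e₂ .int → HasType Γ (.prim o e₁ e₂) o.resTy
  | tt {n m : ℕ} {Γ : TCtx n m} : HasType Γ .tt .bool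
  | ff {n m : ℕ} {Γ : TCtx n m} : HasType Γ .ff .bool
  | cond {n m : ℕ} {Γ : TCtx n m} {e e₁ e₂ : Tm n m} {τ : Ty n} :
      HasType Γ e .bool → HasType Γ e₁ τ → HasType Γ e₂ τ → HasType Γ (.cond e e₁ e₂) τ
  | pair {n m : ℕ} {Γ : TCtx n m} {e₁ e₂ : Tm n m} {τ₁ τ₂ : Ty n} :
      HasType Γ e₁ τ₁ → HasType Γ e₂ τ₂ → HasType Γ (.pair e₁ e₂) (.prod τ₁ τ₂)
  | fst {n m : ℕ} {Γ : TCtx n m} {e : Tm n m} {τ₁ τ₂ : Ty n} :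
      HasType Γ e (.prod τ₁ τ₂) → HasType Γ (.fst e) τ₁
  | snd {n m : ℕ} {Γ : TCtx n m} {e : Tm n m} {τ₁ τ₂ : Ty n} :
      HasType Γ e (.prod τ₁ τ₂) → HasType Γ (.snd e) τ₂
  | inl {n m : ℕ} {Γ : TCtx n m} {e : Tm n m} {τ₁ τ₂ : Ty n} :
      HasType Γ e τ₁ → HasType Γ (.inl (.sum τ₁ τ₂) e) (.sum τ₁ τ₂)
  | inr {n m : ℕ} {Γ : TCtx n m} {e : Tm n m} {τ₁ τ₂ : Ty n} :
      HasType Γ e τ₂ → HasType Γ (.inr (.sum τ₁ τ₂) e) (.sum τ₁ τ₂)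
  | caseOf {n m : ℕ} {Γ : TCtx n m} {e : Tm n m} {e₁ e₂ : Tm n (m + 1)} {τ₁ τ₂ τ : Ty n} :
      HasType Γ e (.sum τ₁ τ₂) → HasType (Γ.extend τ₁) e₁ τ → HasType (Γ.extend τ₂) e₂ τ →
      HasType Γ (.caseOf e e₁ e₂) τ
  | lam {n m : ℕ} {Γ : TCtx n m} {e : Tm n (m + 1)} {τ₁ τ₂ : Ty n} :
      HasType (Γ.extend τ₁) e τ₂ → HasType Γ (.lam τ₁ e) (.arr τ₁ τ₂)
  | app {n m : ℕ} {Γ : TCtx n m} {e₁ e₂ : Tm n m} {τ₂ τ : Ty n} :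
      HasType Γ e₁ (.arr τ₂ τ) → HasType Γ e₂ τ₂ → HasType Γ (.app e₁ e₂) τ
  | tlam {n m : ℕ} {Γ : TCtx n m} {e : Tm (n + 1) m} {τ : Ty (n + 1)} :
      HasType Γ.extendTy e τ → HasType Γ (.tlam e) (.all τ)
  | tapp {n m : ℕ} {Γ : TCtx n m} {e : Tm n m} {τ : Ty (n + 1)} (τ₁ : Ty n) :
      HasType Γ e (.all τ) → HasType Γ (.tapp e τ₁) (τ.inst τ₁)
  | pack {n m : ℕ} {Γ : TCtx n m} {e : Tm n m} {τ : Ty (n + 1)} {τ₁ : Ty n} :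
      HasType Γ e (τ.inst τ₁) → HasType Γ (.pack τ₁ e τ) (.ex τ)
  | unpack {n m : ℕ} {Γ : TCtx n m} {e₁ : Tm n m} {e₂ : Tm (n + 1) (m + 1)}
      {τ₁ : Ty (n + 1)} {τ : Ty n} :
      HasType Γ e₁ (.ex τ₁) → HasType (Γ.extendTy.extend τ₁) e₂ (τ.rename Fin.succ) →
      HasType Γ (.unpack e₁ e₂) τ
  | fold {n m : ℕ} {Γ : TCtx n m} {e : Tm n m} {τ : Ty (n + 1)} :
      HasType Γ e (τ.inst (.mu τ)) → HasType Γ (.fold (.mu τ) e) (.mu τ)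
  | unfold {n m : ℕ} {Γ : TCtx n m} {e : Tm n m} {τ : Ty (n + 1)} :
      HasType Γ e (.mu τ) → HasType Γ (.unfold e) (τ.inst (.mu τ))

/-! ### Program contexts and contextual equivalence -/

/-- Program contexts, i.e. terms with `n'` type variables, `m'` term variables and a single hole
to be filled by a term with `n` type variables and `m` term variables. The hole may stand under
binders, which capture variables of the term put into it; as variables have no names, the hole
records by injections which variables in scope at its position are the free ones of that term. -/
inductive PCtx (n m : ℕ) : ℕ → ℕ → Type
  | hole {n' m' : ℕ} (ξ : Fin n ↪ Fin n') (ρ : Fin m ↪ Fin m') : PCtx n m n' m'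
  | primL {n' m' : ℕ} (o : PrimOp) (C : PCtx n m n' m') (e₂ : Tm n' m') : PCtx n m n' m'
  | primR {n' m' : ℕ} (o : PrimOp) (e₁ : Tm n' m') (C : PCtx n m n' m') : PCtx n m n' m'
  | cond₁ {n' m' : ℕ} (C : PCtx n m n' m') (e₁ e₂ : Tm n' m') : PCtx n m n' m'
  | cond₂ {n' m' : ℕ} (e : Tm n' m') (C : PCtx n m n' m') (e₂ : Tm n' m') : PCtx n m n' m'
  | cond₃ {n' m' : ℕ} (e e₁ : Tm n' m') (C : PCtx n m n' m') : PCtx n m n' m'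
  | pairL {n' m' : ℕ} (C : PCtx n m n' m') (e₂ : Tm n' m') : PCtx n m n' m'
  | pairR {n' m' : ℕ} (e₁ : Tm n' m') (C : PCtx n m n' m') : PCtx n m n' m'
  | fst {n' m' : ℕ} (C : PCtx n m n' m') : PCtx n m n' m'
  | snd {n' m' : ℕ} (C : PCtx n m n' m') : PCtx n m n' m'
  | inl {n' m' : ℕ} (τ : Ty n') (C : PCtx n m n' m') : PCtx n m n' m'
  | inr {n' m' : ℕ} (τ : Ty n') (C : PCtx n m n' m') : PCtx n m n' m'
  | case₁ {n' m' : ℕ} (C : PCtx n m n' m') (e₁ e₂ : Tm n' (m' + 1)) : PCtx n m n' m'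
  | case₂ {n' m' : ℕ} (e : Tm n' m') (C : PCtx n m n' (m' + 1)) (e₂ : Tm n' (m' + 1)) :
      PCtx n m n' m'
  | case₃ {n' m' : ℕ} (e : Tm n' m') (e₁ : Tm n' (m' + 1)) (C : PCtx n m n' (m' + 1)) :
      PCtx n m n' m'
  | lam {n' m' : ℕ} (τ : Ty n') (C : PCtx n m n' (m' + 1)) : PCtx n m n' m'
  | appL {n' m' : ℕ} (C : PCtx n m n' m') (e₂ : Tm n' m') : PCtx n m n' m'
  | appR {n' m' : ℕ} (e₁ : Tm n' m') (C : PCtx n m n' m') : PCtx n m n' m'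
  | tlam {n' m' : ℕ} (C : PCtx n m (n' + 1) m') : PCtx n m n' m'
  | tapp {n' m' : ℕ} (C : PCtx n m n' m') (τ : Ty n') : PCtx n m n' m'
  | pack {n' m' : ℕ} (τ₁ : Ty n') (C : PCtx n m n' m') (τ : Ty (n' + 1)) : PCtx n m n' m'
  | unpackL {n' m' : ℕ} (C : PCtx n m n' m') (e₂ : Tm (n' + 1) (m' + 1)) : PCtx n m n' m'
  | unpackR {n' m' : ℕ} (e₁ : Tm n' m') (C : PCtx n m (n' + 1) (m' + 1)) : PCtx n m n' m'
  | fold {n' m' : ℕ} (τ : Ty n') (C : PCtx n m n' m') : PCtx n m n' m'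
  | unfold {n' m' : ℕ} (C : PCtx n m n' m') : PCtx n m n' m'

/-- `C.plug e` is `C[e]`. -/
def PCtx.plug {n m : ℕ} : {n' m' : ℕ} → PCtx n m n' m' → Tm n m → Tm n' m'
  | _, _, .hole ξ ρ, e => e.rename ξ ρ
  | _, _, .primL o C e₂, e => .prim o (C.plug e) e₂
  | _, _, .primR o e₁ C, e => .prim o e₁ (C.plug e)
  | _, _, .cond₁ C e₁ e₂, e => .cond (C.plug e) e₁ e₂
  | _, _, .cond₂ e₀ C e₂, e => .cond e₀ (C.plug e) e₂
  | _, _, .cond₃ e₀ e₁ C, e => .cond e₀ e₁ (C.plug e)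
  | _, _, .pairL C e₂, e => .pair (C.plug e) e₂
  | _, _, .pairR e₁ C, e => .pair e₁ (C.plug e)
  | _, _, .fst C, e => .fst (C.plug e)
  | _, _, .snd C, e => .snd (C.plug e)
  | _, _, .inl τ C, e => .inl τ (C.plug e)
  | _, _, .inr τ C, e => .inr τ (C.plug e)
  | _, _, .case₁ C e₁ e₂, e => .caseOf (C.plug e) e₁ e₂
  | _, _, .case₂ e₀ C e₂, e => .caseOf e₀ (C.plug e) e₂
  | _, _, .case₃ e₀ e₁ C, e => .caseOf e₀ e₁ (C.plug e)
  | _, _, .lam τ C, e => .lam τ (C.plug e)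
  | _, _, .appL C e₂, e => .app (C.plug e) e₂
  | _, _, .appR e₁ C, e => .app e₁ (C.plug e)
  | _, _, .tlam C, e => .tlam (C.plug e)
  | _, _, .tapp C τ, e => .tapp (C.plug e) τ
  | _, _, .pack τ₁ C τ, e => .pack τ₁ (C.plug e) τ
  | _, _, .unpackL C e₂, e => .unpack (C.plug e) e₂
  | _, _, .unpackR e₁ C, e => .unpack e₁ (C.plug e)
  | _, _, .fold τ C, e => .fold τ (C.plug e)
  | _, _, .unfold C, e => .unfold (C.plug e)

/-- `CtxHasType Γ τ C Γ' τ'` is the judgment `⊢ C : (Γ ⊢ τ) ⇝ (Γ' ⊢ τ')`. In the rule for the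
hole, the hypothesis says that `Γ ⊆ Γ'` along the injections recorded in the hole. -/
inductive CtxHasType {n m : ℕ} (Γ : TCtx n m) (τ : Ty n) :
    {n' m' : ℕ} → PCtx n m n' m' → TCtx n' m' → Ty n' → Prop
  | hole {n' m' : ℕ} {Γ' : TCtx n' m'} (ξ : Fin n ↪ Fin n') (ρ : Fin m ↪ Fin m') :
      (∀ i, Γ' (ρ i) = (Γ i).rename ξ) → CtxHasType Γ τ (.hole ξ ρ) Γ' (τ.rename ξ)
  | primL {n' m' : ℕ} {Γ' : TCtx n' m'} {o : PrimOp} {C : PCtx n m n' m'} {e₂ : Tm n' m'} :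
      CtxHasType Γ τ C Γ' .int → HasType Γ' e₂ .int → CtxHasType Γ τ (.primL o C e₂) Γ' o.resTy
  | primR {n' m' : ℕ} {Γ' : TCtx n' m'} {o : PrimOp} {e₁ : Tm n' m'} {C : PCtx n m n' m'} :
      HasType Γ' e₁ .int → CtxHasType Γ τ C Γ' .int → CtxHasType Γ τ (.primR o e₁ C) Γ' o.resTy
  | cond₁ {n' m' : ℕ} {Γ' : TCtx n' m'} {C : PCtx n m n' m'} {e₁ e₂ : Tm n' m'} {τ' : Ty n'} :
      CtxHasType Γ τ C Γ' .bool → HasType Γ' e₁ τ' → HasType Γ' e₂ τ' →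
      CtxHasType Γ τ (.cond₁ C e₁ e₂) Γ' τ'
  | cond₂ {n' m' : ℕ} {Γ' : TCtx n' m'} {e : Tm n' m'} {C : PCtx n m n' m'} {e₂ : Tm n' m'}
      {τ' : Ty n'} :
      HasType Γ' e .bool → CtxHasType Γ τ C Γ' τ' → HasType Γ' e₂ τ' →
      CtxHasType Γ τ (.cond₂ e C e₂) Γ' τ'
  | cond₃ {n' m' : ℕ} {Γ' : TCtx n' m'} {e e₁ : Tm n' m'} {C : PCtx n m n' m'} {τ' : Ty n'} :
      HasType Γ' e .bool → HasType Γ' e₁ τ' → CtxHasType Γ τ C Γ' τ' →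
      CtxHasType Γ τ (.cond₃ e e₁ C) Γ' τ'
  | pairL {n' m' : ℕ} {Γ' : TCtx n' m'} {C : PCtx n m n' m'} {e₂ : Tm n' m'} {τ₁ τ₂ : Ty n'} :
      CtxHasType Γ τ C Γ' τ₁ → HasType Γ' e₂ τ₂ → CtxHasType Γ τ (.pairL C e₂) Γ' (.prod τ₁ τ₂)
  | pairR {n' m' : ℕ} {Γ' : TCtx n' m'} {e₁ : Tm n' m'} {C : PCtx n m n' m'} {τ₁ τ₂ : Ty n'} :
      HasType Γ' e₁ τ₁ → CtxHasType Γ τ C Γ' τ₂ → CtxHasType Γ τ (.pairR e₁ C) Γ' (.prod τ₁ τ₂)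
  | fst {n' m' : ℕ} {Γ' : TCtx n' m'} {C : PCtx n m n' m'} {τ₁ τ₂ : Ty n'} :
      CtxHasType Γ τ C Γ' (.prod τ₁ τ₂) → CtxHasType Γ τ (.fst C) Γ' τ₁
  | snd {n' m' : ℕ} {Γ' : TCtx n' m'} {C : PCtx n m n' m'} {τ₁ τ₂ : Ty n'} :
      CtxHasType Γ τ C Γ' (.prod τ₁ τ₂) → CtxHasType Γ τ (.snd C) Γ' τ₂
  | inl {n' m' : ℕ} {Γ' : TCtx n' m'} {C : PCtx n m n' m'} {τ₁ τ₂ : Ty n'} :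
      CtxHasType Γ τ C Γ' τ₁ → CtxHasType Γ τ (.inl (.sum τ₁ τ₂) C) Γ' (.sum τ₁ τ₂)
  | inr {n' m' : ℕ} {Γ' : TCtx n' m'} {C : PCtx n m n' m'} {τ₁ τ₂ : Ty n'} :
      CtxHasType Γ τ C Γ' τ₂ → CtxHasType Γ τ (.inr (.sum τ₁ τ₂) C) Γ' (.sum τ₁ τ₂)
  | case₁ {n' m' : ℕ} {Γ' : TCtx n' m'} {C : PCtx n m n' m'} {e₁ e₂ : Tm n' (m' + 1)}
      {τ₁ τ₂ τ' : Ty n'} :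
      CtxHasType Γ τ C Γ' (.sum τ₁ τ₂) → HasType (Γ'.extend τ₁) e₁ τ' →
      HasType (Γ'.extend τ₂) e₂ τ' → CtxHasType Γ τ (.case₁ C e₁ e₂) Γ' τ'
  | case₂ {n' m' : ℕ} {Γ' : TCtx n' m'} {e : Tm n' m'} {C : PCtx n m n' (m' + 1)}
      {e₂ : Tm n' (m' + 1)} {τ₁ τ₂ τ' : Ty n'} :
      HasType Γ' e (.sum τ₁ τ₂) → CtxHasType Γ τ C (Γ'.extend τ₁) τ' →
      HasType (Γ'.extend τ₂) e₂ τ' → CtxHasType Γ τ (.case₂ e C e₂) Γ' τ'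
  | case₃ {n' m' : ℕ} {Γ' : TCtx n' m'} {e : Tm n' m'} {e₁ : Tm n' (m' + 1)}
      {C : PCtx n m n' (m' + 1)} {τ₁ τ₂ τ' : Ty n'} :
      HasType Γ' e (.sum τ₁ τ₂) → HasType (Γ'.extend τ₁) e₁ τ' →
      CtxHasType Γ τ C (Γ'.extend τ₂) τ' → CtxHasType Γ τ (.case₃ e e₁ C) Γ' τ'
  | lam {n' m' : ℕ} {Γ' : TCtx n' m'} {C : PCtx n m n' (m' + 1)} {τ₁ τ₂ : Ty n'} :
      CtxHasType Γ τ C (Γ'.extend τ₁) τ₂ → CtxHasType Γ τ (.lam τ₁ C) Γ' (.arr τ₁ τ₂)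
  | appL {n' m' : ℕ} {Γ' : TCtx n' m'} {C : PCtx n m n' m'} {e₂ : Tm n' m'} {τ₂ τ' : Ty n'} :
      CtxHasType Γ τ C Γ' (.arr τ₂ τ') → HasType Γ' e₂ τ₂ → CtxHasType Γ τ (.appL C e₂) Γ' τ'
  | appR {n' m' : ℕ} {Γ' : TCtx n' m'} {e₁ : Tm n' m'} {C : PCtx n m n' m'} {τ₂ τ' : Ty n'} :
      HasType Γ' e₁ (.arr τ₂ τ') → CtxHasType Γ τ C Γ' τ₂ → CtxHasType Γ τ (.appR e₁ C) Γ' τ'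
  | tlam {n' m' : ℕ} {Γ' : TCtx n' m'} {C : PCtx n m (n' + 1) m'} {τ' : Ty (n' + 1)} :
      CtxHasType Γ τ C Γ'.extendTy τ' → CtxHasType Γ τ (.tlam C) Γ' (.all τ')
  | tapp {n' m' : ℕ} {Γ' : TCtx n' m'} {C : PCtx n m n' m'} {τ' : Ty (n' + 1)} (τ₁ : Ty n') :
      CtxHasType Γ τ C Γ' (.all τ') → CtxHasType Γ τ (.tapp C τ₁) Γ' (τ'.inst τ₁)
  | pack {n' m' : ℕ} {Γ' : TCtx n' m'} {C : PCtx n m n' m'} {τ' : Ty (n' + 1)} {τ₁ : Ty n'} :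
      CtxHasType Γ τ C Γ' (τ'.inst τ₁) → CtxHasType Γ τ (.pack τ₁ C τ') Γ' (.ex τ')
  | unpackL {n' m' : ℕ} {Γ' : TCtx n' m'} {C : PCtx n m n' m'} {e₂ : Tm (n' + 1) (m' + 1)}
      {τ₁ : Ty (n' + 1)} {τ' : Ty n'} :
      CtxHasType Γ τ C Γ' (.ex τ₁) → HasType (Γ'.extendTy.extend τ₁) e₂ (τ'.rename Fin.succ) →
      CtxHasType Γ τ (.unpackL C e₂) Γ' τ'
  | unpackR {n' m' : ℕ} {Γ' : TCtx n' m'} {e₁ : Tm n' m'} {C : PCtx n m (n' + 1) (m' + 1)}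
      {τ₁ : Ty (n' + 1)} {τ' : Ty n'} :
      HasType Γ' e₁ (.ex τ₁) → CtxHasType Γ τ C (Γ'.extendTy.extend τ₁) (τ'.rename Fin.succ) →
      CtxHasType Γ τ (.unpackR e₁ C) Γ' τ'
  | fold {n' m' : ℕ} {Γ' : TCtx n' m'} {C : PCtx n m n' m'} {τ' : Ty (n' + 1)} :
      CtxHasType Γ τ C Γ' (τ'.inst (.mu τ')) → CtxHasType Γ τ (.fold (.mu τ') C) Γ' (.mu τ')
  | unfold {n' m' : ℕ} {Γ' : TCtx n' m'} {C : PCtx n m n' m'} {τ' : Ty (n' + 1)} :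
      CtxHasType Γ τ C Γ' (.mu τ') → CtxHasType Γ τ (.unfold C) Γ' (τ'.inst (.mu τ'))

/-- Contextual approximation `Γ ⊢ e₁ ⪯ e₂ : τ`, for two terms of type `τ`. -/
def CtxApprox {n m : ℕ} (Γ : TCtx n m) (e₁ e₂ : Tm n m) (τ : Ty n) : Prop :=
  HasType Γ e₁ τ ∧ HasType Γ e₂ τ ∧
    ∀ (C : PCtx n m 0 0) (τ' : Ty 0), CtxHasType Γ τ C TCtx.empty τ' →
      Terminates (C.plug e₁) → Terminates (C.plug e₂)

/-- Contextual equivalence `Γ ⊢ e₁ ≈ e₂ : τ`. -/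
def CtxEquiv {n m : ℕ} (Γ : TCtx n m) (e₁ e₂ : Tm n m) (τ : Ty n) : Prop :=
  CtxApprox Γ e₁ e₂ τ ∧ CtxApprox Γ e₂ e₁ τ

/-! ### Recursive functions -/

/-- The type `μβ. β → (τ₁ → τ₂)`. -/
def fixTy {n : ℕ} (τ₁ τ₂ : Ty n) : Ty n :=
  .mu (.arr (.var 0) ((Ty.arr τ₁ τ₂).rename Fin.succ))

/-- `λ y : τ₁. (unfold w) w y`, with `y` not free in `w`. -/
def unrollFun {n m : ℕ} (τ₁ : Ty n) (w : Tm n m) : Tm n m :=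
  .lam τ₁ (.app (.app (.unfold (w.rename id Fin.succ)) (w.rename id Fin.succ)) (.var 0))

/-- The recursive function `fix f (x : τ₁) : τ₂. e`, where in `e` the variable `0` is `x` and the
variable `1` is `f`: it is `λ y. (unfold w) w y` for
`w = fold (λ z. (λ f. λ x. e) (λ y. (unfold z) z y))`, with `y` and `z` not free in `e`. -/
def fixFun {n m : ℕ} (τ₁ τ₂ : Ty n) (e : Tm n (m + 2)) : Tm n m :=
  unrollFun τ₁
    (.fold (fixTy τ₁ τ₂)
      (.lam (fixTy τ₁ τ₂)
        (.app
          (.lam (.arr τ₁ τ₂) (.lam τ₁ (e.rename id (liftRen (liftRen Fin.succ)))))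
          (unrollFun τ₁ (.var 0)))))

/-! ### The identity and the copy function on `μα. unit + (α → α)` -/

/-- `τ = μα. unit + (α → α)`. -/
def recTy : Ty 0 := .mu (.sum .unit (.arr (.var 0) (.var 0)))

/-- The unfolding `unit + (τ → τ)` of `τ`. -/
def recSum : Ty 0 := .sum .unit (.arr recTy recTy)

/-- `λ x : τ. x`. -/
def idFun : Tm 0 0 := .lam recTy (.var 0)

/-- `fix f (x : τ). case (unfold x) of inl _ => fold (inl ⟨⟩)`
`| inr g => fold (inr (λ y : τ. f (g (f y))))`. In the innermost body the variables `0, 1, 2, 3`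
are `y, g, x, f`. -/
def copyFun : Tm 0 0 :=
  fixFun recTy recTy
    (.caseOf (.unfold (.var 0))
      (.fold recTy (.inl recSum .unit))
      (.fold recTy (.inr recSum
        (.lam recTy (.app (.var 3) (.app (.var 1) (.app (.var 3) (.var 0))))))))

end FMu

/-!
The identity and the copy function `copy` are compared by a syntactic simulation; neither step
indices nor a semantic interpretation of types are needed. The relation `Sim Γ e e' τ` is the least
typed congruence such that

* the identity is related to `copy`;
* if `e` is related to `e'` at `τ = μα. unit + (α → α)`, then `e` is related to `copy e'`;
* if an abstraction `g` is related to `g'` at `τ → τ`, then `g` is related to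
  `λ y. copy (g' (copy y))`.

So the right term is the left one with any number of copies inserted, and any number of the wrappers
which copying leaves behind. The relation is reflexive on well-typed terms, hence relates `C[id]` to
`C[copy]` (`CtxHasType.sim`), and it is closed under substitution (`Sim.subst`). The typing it
contains ensures that `copy` is only applied to values `fold (inl ⟨⟩)` and `fold (inr g)`; on the
former it is the identity, on the latter it adds one wrapper, which the third rule absorbs
(`Sim.copy_value`). An application of a wrapped function copies the argument, runs the function, and
leaves a copy around the result, which the second rule absorbs (`Sim.beta`).

Consequently each step on the left is matched by at least one step on the right (`Sim.red`), and a
value on the left forces the right term to evaluate to a related value (`Sim.value`). Termination is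
thus transported from left to right (`Sim.terminates`). Conversely, an infinite reduction on the
left would give one on the right, which determinism excludes if the right term reaches a value; as left
terms do not get stuck (`Sim.progress`), termination is transported from right to left as well
(`Sim.terminates_symm`).
-/

namespace FMu

/-! ### Renaming and substitution -/

@[simp] theorem liftRen_zero {n n' : ℕ} (ξ : Fin n → Fin n') : liftRen ξ 0 = 0 := rfl

theorem liftRen_id {n : ℕ} : liftRen (id : Fin n → Fin n) = id := by
  funext i
  cases i using Fin.cases <;> rfl

theorem liftRen_comp {n n' n'' : ℕ} (ξ' : Fin n' → Fin n'') (ξ : Fin n → Fin n') :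
    liftRen (ξ' ∘ ξ) = liftRen ξ' ∘ liftRen ξ := by
  funext i
  cases i using Fin.cases <;> rfl

namespace Ty

@[simp] theorem liftSub_zero {n n' : ℕ} (θ : Fin n → Ty n') : liftSub θ 0 = .var 0 := rfl

@[simp] theorem liftSub_succ {n n' : ℕ} (θ : Fin n → Ty n') (i : Fin n) :
    liftSub θ i.succ = (θ i).rename Fin.succ := rfl

@[simp] theorem rename_id {n : ℕ} (τ : Ty n) : τ.rename id = τ := by
  induction τ <;> simp_all [rename, liftRen_id]

theorem rename_rename {n n' n'' : ℕ} (ξ : Fin n → Fin n') (ξ' : Fin n' → Fin n'') (τ : Ty n) :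
    (τ.rename ξ).rename ξ' = τ.rename (ξ' ∘ ξ) := by
  induction τ generalizing n' n'' <;> simp_all [rename, liftRen_comp]

theorem liftSub_var {n : ℕ} : liftSub (var : Fin n → Ty n) = var := by
  funext i
  cases i using Fin.cases <;> rfl

@[simp] theorem subst_var {n : ℕ} (τ : Ty n) : τ.subst var = τ := by
  induction τ <;> simp_all [subst, liftSub_var]

theorem liftSub_comp_liftRen {n n' n'' : ℕ} (ξ : Fin n → Fin n') (θ : Fin n' → Ty n'') :
    liftSub θ ∘ liftRen ξ = liftSub (θ ∘ ξ) := by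
  funext i
  cases i using Fin.cases <;> rfl

theorem rename_subst {n n' n'' : ℕ} (ξ : Fin n → Fin n') (θ : Fin n' → Ty n'') (τ : Ty n) :
    (τ.rename ξ).subst θ = τ.subst (θ ∘ ξ) := by
  induction τ generalizing n' n'' <;> simp_all [rename, subst, liftSub_comp_liftRen]

theorem liftSub_rename {n n' n'' : ℕ} (θ : Fin n → Ty n') (ξ : Fin n' → Fin n'') :
    liftSub (fun i => (θ i).rename ξ) = fun i => (liftSub θ i).rename (liftRen ξ) := by
  funext i
  cases i using Fin.cases
  · rfl
  · simp only [liftSub_succ, rename_rename]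
    rfl

theorem subst_rename {n n' n'' : ℕ} (θ : Fin n → Ty n') (ξ : Fin n' → Fin n'') (τ : Ty n) :
    (τ.subst θ).rename ξ = τ.subst (fun i => (θ i).rename ξ) := by
  induction τ generalizing n' n'' <;> simp_all [rename, subst, liftSub_rename]

theorem liftSub_subst {n n' n'' : ℕ} (θ : Fin n → Ty n') (θ' : Fin n' → Ty n'') :
    liftSub (fun i => (θ i).subst θ') = fun i => (liftSub θ i).subst (liftSub θ') := by
  funext i
  cases i using Fin.cases
  · rfl
  · simp only [liftSub_succ, rename_subst, subst_rename]
    rfl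

theorem subst_subst {n n' n'' : ℕ} (θ : Fin n → Ty n') (θ' : Fin n' → Ty n'') (τ : Ty n) :
    (τ.subst θ).subst θ' = τ.subst (fun i => (θ i).subst θ') := by
  induction τ generalizing n' n'' <;> simp_all [subst, liftSub_subst]

theorem inst_rename {n n' : ℕ} (τ : Ty (n + 1)) (τ₁ : Ty n) (ξ : Fin n → Fin n') :
    (τ.inst τ₁).rename ξ = (τ.rename (liftRen ξ)).inst (τ₁.rename ξ) := by
  simp only [inst, subst_rename, rename_subst]
  congr 1
  funext i
  cases i using Fin.cases <;> rfl

theorem rename_succ_subst {n n' : ℕ} (τ : Ty n) (τ₁ : Ty n') (θ : Fin n → Ty n') :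
    (τ.rename Fin.succ).subst (Fin.cases τ₁ θ) = τ.subst θ := by
  rw [rename_subst]
  rfl

theorem inst_subst {n n' : ℕ} (τ : Ty (n + 1)) (τ₁ : Ty n) (θ : Fin n → Ty n') :
    (τ.inst τ₁).subst θ = (τ.subst (liftSub θ)).inst (τ₁.subst θ) := by
  simp only [inst, subst_subst]
  congr 1
  funext i
  cases i using Fin.cases
  · rfl
  · simp [rename_succ_subst, subst]

theorem rename_succ_rename {n n' : ℕ} (τ : Ty n) (ξ : Fin n → Fin n') :
    (τ.rename Fin.succ).rename (liftRen ξ) = (τ.rename ξ).rename Fin.succ := by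
  simp only [rename_rename]
  rfl

theorem rename_succ_subst_lift {n n' : ℕ} (τ : Ty n) (θ : Fin n → Ty n') :
    (τ.rename Fin.succ).subst (liftSub θ) = (τ.subst θ).rename Fin.succ := by
  simp only [rename_subst, subst_rename]
  rfl

end Ty

namespace Tm

@[simp] theorem liftSub_zero {n m m' : ℕ} (σ : Fin m → Tm n m') : liftSub σ 0 = .var 0 := rfl

@[simp] theorem liftSub_succ {n m m' : ℕ} (σ : Fin m → Tm n m') (i : Fin m) :
    liftSub σ i.succ = (σ i).rename id Fin.succ := rfl

theorem rename_rename {n n' n'' m m' m'' : ℕ} (ξ : Fin n → Fin n') (ρ : Fin m → Fin m')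
    (ξ' : Fin n' → Fin n'') (ρ' : Fin m' → Fin m'') (e : Tm n m) :
    (e.rename ξ ρ).rename ξ' ρ' = e.rename (ξ' ∘ ξ) (ρ' ∘ ρ) := by
  induction e generalizing n' n'' m' m'' <;>
    simp only [*, rename, liftRen_comp, Ty.rename_rename, Function.comp_apply]

theorem liftSub_var {n m : ℕ} : liftSub (var : Fin m → Tm n m) = var := by
  funext i
  cases i using Fin.cases <;> rfl

theorem liftTySub_var {n m : ℕ} : liftTySub (var : Fin m → Tm n m) = var := rfl

theorem subst_var {n m : ℕ} (e : Tm n m) : e.subst Ty.var var = e := by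
  induction e <;> simp only [*, subst, liftSub_var, liftTySub_var, Ty.liftSub_var, Ty.subst_var]

theorem liftSub_comp_liftRen {n m m' m'' : ℕ} (ρ : Fin m → Fin m') (σ : Fin m' → Tm n m'') :
    liftSub σ ∘ liftRen ρ = liftSub (σ ∘ ρ) := by
  funext i
  cases i using Fin.cases <;> rfl

theorem liftTySub_comp {n m m' m'' : ℕ} (ρ : Fin m → Fin m') (σ : Fin m' → Tm n m'') :
    liftTySub σ ∘ ρ = liftTySub (σ ∘ ρ) := rfl

theorem rename_subst {n n' n'' m m' m'' : ℕ} (ξ : Fin n → Fin n') (ρ : Fin m → Fin m')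
    (θ : Fin n' → Ty n'') (σ : Fin m' → Tm n'' m'') (e : Tm n m) :
    (e.rename ξ ρ).subst θ σ = e.subst (θ ∘ ξ) (σ ∘ ρ) := by
  induction e generalizing n' n'' m' m'' <;>
    simp only [*, rename, subst, liftSub_comp_liftRen, liftTySub_comp, Ty.liftSub_comp_liftRen,
      Ty.rename_subst, Function.comp_apply]

theorem liftSub_rename {n n' m m' m'' : ℕ} (σ : Fin m → Tm n m') (ξ : Fin n → Fin n')
    (ρ : Fin m' → Fin m'') :
    liftSub (fun i => (σ i).rename ξ ρ) = fun i => (liftSub σ i).rename ξ (liftRen ρ) := by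
  funext i
  cases i using Fin.cases
  · rfl
  · simp only [liftSub_succ, rename_rename]
    rfl

theorem liftTySub_rename {n n' m m' m'' : ℕ} (σ : Fin m → Tm n m') (ξ : Fin n → Fin n')
    (ρ : Fin m' → Fin m'') :
    liftTySub (fun i => (σ i).rename ξ ρ) = fun i => (liftTySub σ i).rename (liftRen ξ) ρ := by
  funext i
  simp only [liftTySub, rename_rename]
  rfl

theorem subst_rename {n n' n'' m m' m'' : ℕ} (θ : Fin n → Ty n') (σ : Fin m → Tm n' m')
    (ξ : Fin n' → Fin n'') (ρ : Fin m' → Fin m'') (e : Tm n m) :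
    (e.subst θ σ).rename ξ ρ =
      e.subst (fun i => (θ i).rename ξ) (fun i => (σ i).rename ξ ρ) := by
  induction e generalizing n' n'' m' m'' <;>
    simp only [*, rename, subst, liftSub_rename, liftTySub_rename, Ty.liftSub_rename,
      Ty.subst_rename]

theorem weaken_rename {n n' m m' : ℕ} (ξ : Fin n → Fin n') (ρ : Fin m → Fin m') (e : Tm n m) :
    (e.rename id Fin.succ).rename ξ (liftRen ρ) = (e.rename ξ ρ).rename id Fin.succ := by
  simp only [rename_rename]
  rfl

theorem weaken_subst {n n' m m' : ℕ} (θ : Fin n → Ty n') (σ : Fin m → Tm n' m') (e : Tm n m) :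
    (e.rename id Fin.succ).subst θ (liftSub σ) = (e.subst θ σ).rename id Fin.succ := by
  simp only [rename_subst, subst_rename, Ty.rename_id]
  rfl

@[simp] theorem weaken_subst_cases {n m : ℕ} (e v : Tm n m) :
    (e.rename id Fin.succ).subst Ty.var (Fin.cases v var) = e := by
  rw [rename_subst]
  exact subst_var e

end Tm

/-! ### Reduction by structural congruence rules -/

/-- One-step reduction with one congruence rule for each evaluation frame in place of evaluation
contexts, so that it can be inverted on the head constructor of a term. It has the same steps as
`Step`, see `step_iff_red`. -/
inductive Red : {n m : ℕ} → Tm n m → Tm n m → Prop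
  | prim {n m : ℕ} (o : PrimOp) (a b : ℤ) :
      Red (.prim o (.int a) (.int b) : Tm n m) (o.eval a b)
  | condTrue {n m : ℕ} (e₁ e₂ : Tm n m) : Red (.cond .tt e₁ e₂) e₁
  | condFalse {n m : ℕ} (e₁ e₂ : Tm n m) : Red (.cond .ff e₁ e₂) e₂
  | fst {n m : ℕ} {v₁ v₂ : Tm n m} : IsValue v₁ → IsValue v₂ → Red (.fst (.pair v₁ v₂)) v₁
  | snd {n m : ℕ} {v₁ v₂ : Tm n m} : IsValue v₁ → IsValue v₂ → Red (.snd (.pair v₁ v₂)) v₂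
  | caseInl {n m : ℕ} {τ : Ty n} {v : Tm n m} {e₁ e₂ : Tm n (m + 1)} :
      IsValue v → Red (.caseOf (.inl τ v) e₁ e₂) (e₁.instTm v)
  | caseInr {n m : ℕ} {τ : Ty n} {v : Tm n m} {e₁ e₂ : Tm n (m + 1)} :
      IsValue v → Red (.caseOf (.inr τ v) e₁ e₂) (e₂.instTm v)
  | beta {n m : ℕ} {τ : Ty n} {e : Tm n (m + 1)} {v : Tm n m} :
      IsValue v → Red (.app (.lam τ e) v) (e.instTm v)
  | tbeta {n m : ℕ} (e : Tm (n + 1) m) (τ : Ty n) : Red (.tapp (.tlam e) τ) (e.instTy τ)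
  | unpack {n m : ℕ} {τ₁ : Ty n} {v : Tm n m} {τ : Ty (n + 1)} {e : Tm (n + 1) (m + 1)} :
      IsValue v → Red (.unpack (.pack τ₁ v τ) e) (e.instTyTm τ₁ v)
  | unfold {n m : ℕ} {τ : Ty n} {v : Tm n m} : IsValue v → Red (.unfold (.fold τ v)) v
  | primL {n m : ℕ} {o : PrimOp} {e e' e₂ : Tm n m} :
      Red e e' → Red (.prim o e e₂) (.prim o e' e₂)
  | primR {n m : ℕ} {o : PrimOp} {v e e' : Tm n m} :
      IsValue v → Red e e' → Red (.prim o v e) (.prim o v e')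
  | condC {n m : ℕ} {e e' e₁ e₂ : Tm n m} : Red e e' → Red (.cond e e₁ e₂) (.cond e' e₁ e₂)
  | pairL {n m : ℕ} {e e' e₂ : Tm n m} : Red e e' → Red (.pair e e₂) (.pair e' e₂)
  | pairR {n m : ℕ} {v e e' : Tm n m} : IsValue v → Red e e' → Red (.pair v e) (.pair v e')
  | fstC {n m : ℕ} {e e' : Tm n m} : Red e e' → Red (.fst e) (.fst e')
  | sndC {n m : ℕ} {e e' : Tm n m} : Red e e' → Red (.snd e) (.snd e')
  | inlC {n m : ℕ} {τ : Ty n} {e e' : Tm n m} : Red e e' → Red (.inl τ e) (.inl τ e')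
  | inrC {n m : ℕ} {τ : Ty n} {e e' : Tm n m} : Red e e' → Red (.inr τ e) (.inr τ e')
  | caseC {n m : ℕ} {e e' : Tm n m} {e₁ e₂ : Tm n (m + 1)} :
      Red e e' → Red (.caseOf e e₁ e₂) (.caseOf e' e₁ e₂)
  | appL {n m : ℕ} {e e' e₂ : Tm n m} : Red e e' → Red (.app e e₂) (.app e' e₂)
  | appR {n m : ℕ} {v e e' : Tm n m} : IsValue v → Red e e' → Red (.app v e) (.app v e')
  | tappC {n m : ℕ} {e e' : Tm n m} {τ : Ty n} : Red e e' → Red (.tapp e τ) (.tapp e' τ)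
  | packC {n m : ℕ} {τ₁ : Ty n} {e e' : Tm n m} {τ : Ty (n + 1)} :
      Red e e' → Red (.pack τ₁ e τ) (.pack τ₁ e' τ)
  | unpackC {n m : ℕ} {e e' : Tm n m} {e₂ : Tm (n + 1) (m + 1)} :
      Red e e' → Red (.unpack e e₂) (.unpack e' e₂)
  | foldC {n m : ℕ} {τ : Ty n} {e e' : Tm n m} : Red e e' → Red (.fold τ e) (.fold τ e')
  | unfoldC {n m : ℕ} {e e' : Tm n m} : Red e e' → Red (.unfold e) (.unfold e')

theorem Red.fill {n m : ℕ} (E : ECtx n m) {e e' : Tm n m} (h : Red e e') :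
    Red (E.fill e) (E.fill e') := by
  induction E <;> simp only [ECtx.fill] <;> first | exact h | (constructor <;> assumption)

theorem Step.red {n m : ℕ} {e e' : Tm n m} (h : Step e e') : Red e e' := by
  induction h with
  | ctx E _ ih => exact ih.fill E
  | _ => constructor <;> assumption

theorem Red.step {n m : ℕ} {e e' : Tm n m} (h : Red e e') : Step e e' := by
  induction h with
  | prim => exact .prim _ _ _
  | condTrue => exact .condTrue _ _
  | condFalse => exact .condFalse _ _
  | fst h₁ h₂ => exact .fst h₁ h₂
  | snd h₁ h₂ => exact .snd h₁ h₂
  | caseInl h => exact .caseInl h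
  | caseInr h => exact .caseInr h
  | beta h => exact .beta h
  | tbeta => exact .tbeta _ _
  | unpack h => exact .unpack h
  | unfold h => exact .unfold h
  | primL _ ih => exact .ctx (.primL _ .hole _) ih
  | primR hv _ ih => exact .ctx (.primR _ _ hv .hole) ih
  | condC _ ih => exact .ctx (.cond .hole _ _) ih
  | pairL _ ih => exact .ctx (.pairL .hole _) ih
  | pairR hv _ ih => exact .ctx (.pairR _ hv .hole) ih
  | fstC _ ih => exact .ctx (.fst .hole) ih
  | sndC _ ih => exact .ctx (.snd .hole) ih
  | inlC _ ih => exact .ctx (.inl _ .hole) ih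
  | inrC _ ih => exact .ctx (.inr _ .hole) ih
  | caseC _ ih => exact .ctx (.caseOf .hole _ _) ih
  | appL _ ih => exact .ctx (.appL .hole _) ih
  | appR hv _ ih => exact .ctx (.appR _ hv .hole) ih
  | tappC _ ih => exact .ctx (.tapp .hole _) ih
  | packC _ ih => exact .ctx (.pack _ .hole _) ih
  | unpackC _ ih => exact .ctx (.unpack .hole _) ih
  | foldC _ ih => exact .ctx (.fold _ .hole) ih
  | unfoldC _ ih => exact .ctx (.unfold .hole) ih

theorem step_iff_red {n m : ℕ} {e e' : Tm n m} : Step e e' ↔ Red e e' :=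
  ⟨Step.red, Red.step⟩

theorem IsValue.not_red {n m : ℕ} {v e : Tm n m} (hv : IsValue v) : ¬ Red v e := by
  induction hv generalizing e <;> intro h <;> cases h <;> simp_all

theorem Red.deterministic {n m : ℕ} {e e₁ e₂ : Tm n m} (h₁ : Red e e₁) (h₂ : Red e e₂) :
    e₁ = e₂ := by
  induction h₁ generalizing e₂ with
  | prim => cases h₂ <;> first | rfl | (exfalso; exact IsValue.not_red (.int _) ‹_›)
  | condTrue => cases h₂ <;> first | rfl | (exfalso; exact IsValue.not_red .tt ‹_›)
  | condFalse => cases h₂ <;> first | rfl | (exfalso; exact IsValue.not_red .ff ‹_›)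
  | fst h h' => cases h₂ <;> first | rfl | (exfalso; exact IsValue.not_red (.pair h h') ‹_›)
  | snd h h' => cases h₂ <;> first | rfl | (exfalso; exact IsValue.not_red (.pair h h') ‹_›)
  | caseInl h => cases h₂ <;> first | rfl | (exfalso; exact IsValue.not_red (.inl h) ‹_›)
  | caseInr h => cases h₂ <;> first | rfl | (exfalso; exact IsValue.not_red (.inr h) ‹_›)
  | beta h =>
    cases h₂ <;> first
      | rfl
      | (exfalso; exact IsValue.not_red (.lam _ _) ‹_›)
      | (exfalso; exact IsValue.not_red h ‹_›)
  | tbeta => cases h₂ <;> first | rfl | (exfalso; exact IsValue.not_red (.tlam _) ‹_›)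
  | unpack h => cases h₂ <;> first | rfl | (exfalso; exact IsValue.not_red (.pack h) ‹_›)
  | unfold h => cases h₂ <;> first | rfl | (exfalso; exact IsValue.not_red (.fold h) ‹_›)
  | primL h ih | condC h ih | pairL h ih | fstC h ih | sndC h ih | inlC h ih | inrC h ih
  | caseC h ih | appL h ih | tappC h ih | packC h ih | unpackC h ih | foldC h ih
  | unfoldC h ih =>
    cases h₂ <;> first
      | (exfalso; exact IsValue.not_red (by first | assumption | constructor <;> assumption) h)
      | rw [ih ‹Red _ _›]
  | primR hv h ih | pairR hv h ih | appR hv h ih =>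
    cases h₂ <;> first
      | (exfalso; exact IsValue.not_red hv ‹_›)
      | (exfalso; exact IsValue.not_red (by first | assumption | constructor) h)
      | rw [ih ‹Red _ _›]

/-- Many-step reduction. -/
abbrev Reds {n m : ℕ} (e e' : Tm n m) : Prop := Relation.ReflTransGen Red e e'

/-- Reduction in at least one step. -/
abbrev RedPlus {n m : ℕ} (e e' : Tm n m) : Prop := Relation.TransGen Red e e'

theorem terminates_iff {n m : ℕ} {e : Tm n m} :
    Terminates e ↔ ∃ v, Reds e v ∧ IsValue v := by
  have : (Step : Tm n m → Tm n m → Prop) = Red := by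
    funext e e'
    exact propext step_iff_red
  rw [Terminates, this]

/-! ### The copy function -/

/-- The copy function in a context with `n` type and `m` term variables. -/
def copyTm (n m : ℕ) : Tm n m := copyFun.rename Fin.elim0 Fin.elim0

/-- `μα. unit + (α → α)` in a context with `n` type variables. -/
abbrev recTyIn (n : ℕ) : Ty n := .mu (.sum .unit (.arr (.var 0) (.var 0)))

/-- The unfolding of `recTyIn n`. -/
abbrev recSumIn (n : ℕ) : Ty n := .sum .unit (.arr (recTyIn n) (recTyIn n))

theorem recTyIn_inst (n : ℕ) :
    (Ty.sum .unit (.arr (.var 0) (.var 0)) : Ty (n + 1)).inst (recTyIn n) = recSumIn n := rfl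

@[simp] theorem recTyIn_rename {n n' : ℕ} (ξ : Fin n → Fin n') :
    (recTyIn n).rename ξ = recTyIn n' := rfl

@[simp] theorem recTyIn_subst {n n' : ℕ} (θ : Fin n → Ty n') :
    (recTyIn n).subst θ = recTyIn n' := rfl

theorem copyFun_rename {n m : ℕ} (ξ : Fin 0 → Fin n) (ρ : Fin 0 → Fin m) :
    copyFun.rename ξ ρ = copyTm n m := by
  rw [copyTm, Subsingleton.elim ξ Fin.elim0, Subsingleton.elim ρ Fin.elim0]

@[simp] theorem copyTm_rename {n n' m m' : ℕ} (ξ : Fin n → Fin n') (ρ : Fin m → Fin m') :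
    (copyTm n m).rename ξ ρ = copyTm n' m' := by
  rw [copyTm, Tm.rename_rename, copyFun_rename]

/-- The functional `λ f. λ x. …` whose fixed point is the copy function. -/
def copyGen (n m : ℕ) : Tm n m :=
  .lam (.arr (recTyIn n) (recTyIn n)) (.lam (recTyIn n)
    (.caseOf (.unfold (.var 0))
      (.fold (recTyIn n) (.inl (recSumIn n) .unit))
      (.fold (recTyIn n) (.inr (recSumIn n)
        (.lam (recTyIn n) (.app (.var 3) (.app (.var 1) (.app (.var 3) (.var 0)))))))))

/-- The function `λ z. (λ f. λ x. …) (λ y. (unfold z) z y)` under the `fold` of the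
self-application argument. -/
def copySelfBody (n m : ℕ) : Tm n m :=
  .lam (fixTy (recTyIn n) (recTyIn n))
    (.app (copyGen n (m + 1)) (unrollFun (recTyIn n) (.var 0)))

/-- The argument `w` of the self-application in the encoding of the copy function. -/
def copySelf (n m : ℕ) : Tm n m := .fold (fixTy (recTyIn n) (recTyIn n)) (copySelfBody n m)

/-- The function that wraps `g` by the copy function on both sides: `λ y. copy (g (copy y))`. -/
def wrap {n m : ℕ} (g : Tm n m) : Tm n m :=
  .lam (recTyIn n) (.app (copyTm n (m + 1))
    (.app (g.rename id Fin.succ) (.app (copyTm n (m + 1)) (.var 0))))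

theorem wrap_rename {n n' m m' : ℕ} (ξ : Fin n → Fin n') (ρ : Fin m → Fin m') (g : Tm n m) :
    (wrap g).rename ξ ρ = wrap (g.rename ξ ρ) := by
  simp [wrap, Tm.rename, Tm.weaken_rename, liftRen_zero]

@[simp] theorem copyTm_subst {n n' m m' : ℕ} (θ : Fin n → Ty n') (σ : Fin m → Tm n' m') :
    (copyTm n m).subst θ σ = copyTm n' m' := by
  rfl

theorem wrap_subst {n n' m m' : ℕ} (θ : Fin n → Ty n') (σ : Fin m → Tm n' m') (g : Tm n m) :
    (wrap g).subst θ σ = wrap (g.subst θ σ) := by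
  simp [wrap, Tm.subst, Tm.weaken_subst]

theorem copyTm_isValue (n m : ℕ) : IsValue (copyTm n m) := .lam _ _

theorem wrap_isValue {n m : ℕ} (g : Tm n m) : IsValue (wrap g) := .lam _ _

/-- Applied to a value, the copy function reaches its case distinction, in which the recursive
function variable has become the copy function itself. -/
theorem copyTm_app_unroll {n m : ℕ} {v : Tm n m} (hv : IsValue v) :
    RedPlus (.app (copyTm n m) v)
      (.caseOf (.unfold v)
        (.fold (recTyIn n) (.inl (recSumIn n) .unit))
        (.fold (recTyIn n) (.inr (recSumIn n) (wrap (.var 0))))) := by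
  have hw : IsValue (copySelf n m) := .fold (.lam _ _)
  have h₁ : Red (.app (copyTm n m) v)
      (.app (.app (.unfold (copySelf n m)) (copySelf n m)) v) := .beta hv
  have h₂ : Red (.unfold (copySelf n m)) (copySelfBody n m) := .unfold (.lam _ _)
  have h₃ : Red (.app (copySelfBody n m) (copySelf n m)) (.app (copyGen n m) (copyTm n m)) :=
    .beta hw
  have h₄ : Red (.app (copyGen n m) (copyTm n m)) (.lam (recTyIn n)
      (.caseOf (.unfold (.var 0))
        (.fold (recTyIn n) (.inl (recSumIn n) .unit))
        (.fold (recTyIn n) (.inr (recSumIn n) (wrap (.var 0)))))) := .beta (.lam _ _)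
  exact .head h₁ (.head (.appL (.appL h₂)) (.head (.appL h₃) (.head (.appL h₄)
    (.single (.beta hv)))))

theorem copyTm_app_inl {n m : ℕ} :
    RedPlus (.app (copyTm n m) (.fold (recTyIn n) (.inl (recSumIn n) .unit)))
      (.fold (recTyIn n) (.inl (recSumIn n) .unit)) := by
  refine (copyTm_app_unroll (.fold (.inl .unit))).trans ?_
  exact .head (.caseC (.unfold (.inl .unit))) (.single (.caseInl .unit))

theorem copyTm_app_inr {n m : ℕ} {g : Tm n m} (hg : IsValue g) :
    RedPlus (.app (copyTm n m) (.fold (recTyIn n) (.inr (recSumIn n) g)))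
      (.fold (recTyIn n) (.inr (recSumIn n) (wrap g))) := by
  refine (copyTm_app_unroll (.fold (.inr hg))).trans ?_
  exact .head (.caseC (.unfold (.inr hg))) (.single (.caseInr hg))

/-! ### The simulation relation -/

/-- `Sim Γ e e' τ`: both terms have type `τ` in `Γ`, and `e'` arises from `e` by replacing
identities on `μα. unit + (α → α)` by the copy function, applying the copy function to subterms of
this type, and wrapping functions between such subterms. The last three constructors are these
three rules, the others are one congruence rule for each typing rule. -/
inductive Sim : {n m : ℕ} → TCtx n m → Tm n m → Tm n m → Ty n → Prop
  | var {n m : ℕ} {Γ : TCtx n m} (i : Fin m) : Sim Γ (.var i) (.var i) (Γ i)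
  | unit {n m : ℕ} {Γ : TCtx n m} : Sim Γ .unit .unit .unit
  | int {n m : ℕ} {Γ : TCtx n m} (k : ℤ) : Sim Γ (.int k) (.int k) .int
  | prim {n m : ℕ} {Γ : TCtx n m} (o : PrimOp) {e₁ e₂ e₁' e₂' : Tm n m} :
      Sim Γ e₁ e₁' .int → Sim Γ e₂ e₂' .int → Sim Γ (.prim o e₁ e₂) (.prim o e₁' e₂') o.resTy
  | tt {n m : ℕ} {Γ : TCtx n m} : Sim Γ .tt .tt .bool
  | ff {n m : ℕ} {Γ : TCtx n m} : Sim Γ .ff .ff .bool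
  | cond {n m : ℕ} {Γ : TCtx n m} {e e₁ e₂ e' e₁' e₂' : Tm n m} {τ : Ty n} :
      Sim Γ e e' .bool → Sim Γ e₁ e₁' τ → Sim Γ e₂ e₂' τ →
      Sim Γ (.cond e e₁ e₂) (.cond e' e₁' e₂') τ
  | pair {n m : ℕ} {Γ : TCtx n m} {e₁ e₂ e₁' e₂' : Tm n m} {τ₁ τ₂ : Ty n} :
      Sim Γ e₁ e₁' τ₁ → Sim Γ e₂ e₂' τ₂ → Sim Γ (.pair e₁ e₂) (.pair e₁' e₂') (.prod τ₁ τ₂)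
  | fst {n m : ℕ} {Γ : TCtx n m} {e e' : Tm n m} {τ₁ τ₂ : Ty n} :
      Sim Γ e e' (.prod τ₁ τ₂) → Sim Γ (.fst e) (.fst e') τ₁
  | snd {n m : ℕ} {Γ : TCtx n m} {e e' : Tm n m} {τ₁ τ₂ : Ty n} :
      Sim Γ e e' (.prod τ₁ τ₂) → Sim Γ (.snd e) (.snd e') τ₂
  | inl {n m : ℕ} {Γ : TCtx n m} {e e' : Tm n m} {τ₁ τ₂ : Ty n} :
      Sim Γ e e' τ₁ → Sim Γ (.inl (.sum τ₁ τ₂) e) (.inl (.sum τ₁ τ₂) e') (.sum τ₁ τ₂)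
  | inr {n m : ℕ} {Γ : TCtx n m} {e e' : Tm n m} {τ₁ τ₂ : Ty n} :
      Sim Γ e e' τ₂ → Sim Γ (.inr (.sum τ₁ τ₂) e) (.inr (.sum τ₁ τ₂) e') (.sum τ₁ τ₂)
  | caseOf {n m : ℕ} {Γ : TCtx n m} {e e' : Tm n m} {e₁ e₂ e₁' e₂' : Tm n (m + 1)}
      {τ₁ τ₂ τ : Ty n} :
      Sim Γ e e' (.sum τ₁ τ₂) → Sim (Γ.extend τ₁) e₁ e₁' τ → Sim (Γ.extend τ₂) e₂ e₂' τ →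
      Sim Γ (.caseOf e e₁ e₂) (.caseOf e' e₁' e₂') τ
  | lam {n m : ℕ} {Γ : TCtx n m} {e e' : Tm n (m + 1)} {τ₁ τ₂ : Ty n} :
      Sim (Γ.extend τ₁) e e' τ₂ → Sim Γ (.lam τ₁ e) (.lam τ₁ e') (.arr τ₁ τ₂)
  | app {n m : ℕ} {Γ : TCtx n m} {e₁ e₂ e₁' e₂' : Tm n m} {τ₂ τ : Ty n} :
      Sim Γ e₁ e₁' (.arr τ₂ τ) → Sim Γ e₂ e₂' τ₂ → Sim Γ (.app e₁ e₂) (.app e₁' e₂') τ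
  | tlam {n m : ℕ} {Γ : TCtx n m} {e e' : Tm (n + 1) m} {τ : Ty (n + 1)} :
      Sim Γ.extendTy e e' τ → Sim Γ (.tlam e) (.tlam e') (.all τ)
  | tapp {n m : ℕ} {Γ : TCtx n m} {e e' : Tm n m} {τ : Ty (n + 1)} (τ₁ : Ty n) :
      Sim Γ e e' (.all τ) → Sim Γ (.tapp e τ₁) (.tapp e' τ₁) (τ.inst τ₁)
  | pack {n m : ℕ} {Γ : TCtx n m} {e e' : Tm n m} {τ : Ty (n + 1)} {τ₁ : Ty n} :
      Sim Γ e e' (τ.inst τ₁) → Sim Γ (.pack τ₁ e τ) (.pack τ₁ e' τ) (.ex τ)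
  | unpack {n m : ℕ} {Γ : TCtx n m} {e₁ e₁' : Tm n m} {e₂ e₂' : Tm (n + 1) (m + 1)}
      {τ₁ : Ty (n + 1)} {τ : Ty n} :
      Sim Γ e₁ e₁' (.ex τ₁) → Sim (Γ.extendTy.extend τ₁) e₂ e₂' (τ.rename Fin.succ) →
      Sim Γ (.unpack e₁ e₂) (.unpack e₁' e₂') τ
  | fold {n m : ℕ} {Γ : TCtx n m} {e e' : Tm n m} {τ : Ty (n + 1)} :
      Sim Γ e e' (τ.inst (.mu τ)) → Sim Γ (.fold (.mu τ) e) (.fold (.mu τ) e') (.mu τ)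
  | unfold {n m : ℕ} {Γ : TCtx n m} {e e' : Tm n m} {τ : Ty (n + 1)} :
      Sim Γ e e' (.mu τ) → Sim Γ (.unfold e) (.unfold e') (τ.inst (.mu τ))
  | idCopy {n m : ℕ} {Γ : TCtx n m} :
      Sim Γ (.lam (recTyIn n) (.var 0)) (copyTm n m) (.arr (recTyIn n) (recTyIn n))
  | copy {n m : ℕ} {Γ : TCtx n m} {e e' : Tm n m} :
      Sim Γ e e' (recTyIn n) → Sim Γ e (.app (copyTm n m) e') (recTyIn n)
  /-- The term on the left is an abstraction and not an arbitrary term of function type, since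
  that one may diverge while a wrapped function is a value. -/
  | wrap {n m : ℕ} {Γ : TCtx n m} {e : Tm n (m + 1)} {g : Tm n m} :
      Sim Γ (.lam (recTyIn n) e) g (.arr (recTyIn n) (recTyIn n)) →
      Sim Γ (.lam (recTyIn n) e) (wrap g) (.arr (recTyIn n) (recTyIn n))

/-- Reflexivity on well-typed terms. -/
theorem HasType.sim {n m : ℕ} {Γ : TCtx n m} {e : Tm n m} {τ : Ty n} (h : HasType Γ e τ) :
    Sim Γ e e τ := by
  induction h <;> constructor <;> assumption

/-- A context filled with the identity is related to the same context filled with the copy function,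
also when the hole stands under binders: both terms are closed. -/
theorem CtxHasType.sim {n' m' : ℕ} {C : PCtx 0 0 n' m'} {Γ' : TCtx n' m'} {τ' : Ty n'}
    (h : CtxHasType TCtx.empty (.arr recTy recTy) C Γ' τ') :
    Sim Γ' (C.plug idFun) (C.plug copyFun) τ' := by
  induction h with
  | hole _ _ _ =>
    rw [PCtx.plug, PCtx.plug, copyFun_rename]
    exact .idCopy
  | _ => constructor <;> first | assumption | exact HasType.sim ‹_›

theorem PrimOp.resTy_rename {n n' : ℕ} (o : PrimOp) (ξ : Fin n → Fin n') :
    (o.resTy : Ty n).rename ξ = o.resTy := by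
  cases o <;> rfl

theorem PrimOp.resTy_subst {n n' : ℕ} (o : PrimOp) (θ : Fin n → Ty n') :
    (o.resTy : Ty n).subst θ = o.resTy := by
  cases o <;> rfl

theorem TCtx.extend_rename {n m n' m' : ℕ} {Γ : TCtx n m} {Δ : TCtx n' m'} {ξ : Fin n → Fin n'}
    {ρ : Fin m → Fin m'} (h : ∀ i, Δ (ρ i) = (Γ i).rename ξ) (τ : Ty n) (i : Fin (m + 1)) :
    Δ.extend (τ.rename ξ) (liftRen ρ i) = (Γ.extend τ i).rename ξ := by
  cases i using Fin.cases
  · rfl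
  · exact h _

theorem TCtx.extendTy_rename {n m n' m' : ℕ} {Γ : TCtx n m} {Δ : TCtx n' m'}
    {ξ : Fin n → Fin n'} {ρ : Fin m → Fin m'} (h : ∀ i, Δ (ρ i) = (Γ i).rename ξ) (i : Fin m) :
    Δ.extendTy (ρ i) = (Γ.extendTy i).rename (liftRen ξ) := by
  simp only [TCtx.extendTy, h, Ty.rename_succ_rename]

theorem Sim.rename {n m n' m' : ℕ} {Γ : TCtx n m} {Δ : TCtx n' m'} {e e' : Tm n m} {τ : Ty n}
    (h : Sim Γ e e' τ) (ξ : Fin n → Fin n') (ρ : Fin m → Fin m')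
    (hρ : ∀ i, Δ (ρ i) = (Γ i).rename ξ) :
    Sim Δ (e.rename ξ ρ) (e'.rename ξ ρ) (τ.rename ξ) := by
  induction h generalizing n' m' with
  | var i => rw [← hρ]; exact .var _
  | prim o _ _ ih₁ ih₂ => rw [PrimOp.resTy_rename]; exact .prim o (ih₁ _ _ hρ) (ih₂ _ _ hρ)
  | caseOf _ _ _ ih ih₁ ih₂ =>
    exact .caseOf (ih _ _ hρ) (ih₁ _ _ (TCtx.extend_rename hρ _))
      (ih₂ _ _ (TCtx.extend_rename hρ _))
  | lam _ ih => exact .lam (ih _ _ (TCtx.extend_rename hρ _))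
  | tlam _ ih => exact .tlam (ih _ _ (TCtx.extendTy_rename hρ))
  | tapp τ₁ _ ih => rw [Ty.inst_rename]; exact .tapp _ (ih _ _ hρ)
  | pack _ ih =>
    refine .pack ?_
    rw [← Ty.inst_rename]
    exact ih _ _ hρ
  | unpack _ _ ih₁ ih₂ =>
    refine .unpack (ih₁ _ _ hρ) ?_
    rw [← Ty.rename_succ_rename]
    exact ih₂ _ _ (TCtx.extend_rename (TCtx.extendTy_rename hρ) _)
  | fold _ ih =>
    refine .fold ?_
    have := ih _ _ hρ
    rwa [Ty.inst_rename] at this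
  | unfold _ ih => rw [Ty.inst_rename]; exact .unfold (ih _ _ hρ)
  | idCopy => rw [copyTm_rename]; exact .idCopy
  | copy _ ih =>
    rw [Tm.rename, copyTm_rename]
    exact .copy (ih _ _ hρ)
  | wrap _ ih =>
    rw [wrap_rename]
    exact .wrap (ih _ _ hρ)
  | unit => exact .unit
  | int k => exact .int k
  | tt => exact .tt
  | ff => exact .ff
  | cond _ _ _ ih ih₁ ih₂ => exact .cond (ih _ _ hρ) (ih₁ _ _ hρ) (ih₂ _ _ hρ)
  | pair _ _ ih₁ ih₂ => exact .pair (ih₁ _ _ hρ) (ih₂ _ _ hρ)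
  | fst _ ih => exact .fst (ih _ _ hρ)
  | snd _ ih => exact .snd (ih _ _ hρ)
  | inl _ ih => exact .inl (ih _ _ hρ)
  | inr _ ih => exact .inr (ih _ _ hρ)
  | app _ _ ih₁ ih₂ => exact .app (ih₁ _ _ hρ) (ih₂ _ _ hρ)

/-- `SubstSim Γ Δ θ σ σ'`: the substitutions `σ` and `σ'` send the variables of `Γ` to related terms
in `Δ`, at types substituted by `θ`. -/
def SubstSim {n m n' m' : ℕ} (Γ : TCtx n m) (Δ : TCtx n' m') (θ : Fin n → Ty n')
    (σ σ' : Fin m → Tm n' m') : Prop :=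
  ∀ i, Sim Δ (σ i) (σ' i) ((Γ i).subst θ)

theorem SubstSim.extend_subst {n m n' m' : ℕ} {Γ : TCtx n m} {Δ : TCtx n' m'} {θ : Fin n → Ty n'}
    {σ σ' : Fin m → Tm n' m'} (h : SubstSim Γ Δ θ σ σ') (τ : Ty n) :
    SubstSim (Γ.extend τ) (Δ.extend (τ.subst θ)) θ (Tm.liftSub σ) (Tm.liftSub σ') := by
  intro i
  cases i using Fin.cases with
  | zero => exact .var 0
  | succ i =>
    have := (h i).rename (Δ := Δ.extend (τ.subst θ)) id Fin.succ fun j => (Ty.rename_id _).symm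
    rwa [Ty.rename_id] at this

theorem SubstSim.extendTy_subst {n m n' m' : ℕ} {Γ : TCtx n m} {Δ : TCtx n' m'}
    {θ : Fin n → Ty n'} {σ σ' : Fin m → Tm n' m'} (h : SubstSim Γ Δ θ σ σ') :
    SubstSim Γ.extendTy Δ.extendTy (Ty.liftSub θ) (Tm.liftTySub σ) (Tm.liftTySub σ') := by
  intro i
  have := (h i).rename (Δ := Δ.extendTy) Fin.succ id fun j => rfl
  rwa [← Ty.rename_succ_subst_lift] at this

theorem Sim.subst {n m n' m' : ℕ} {Γ : TCtx n m} {Δ : TCtx n' m'} {e e' : Tm n m} {τ : Ty n}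
    (h : Sim Γ e e' τ) {θ : Fin n → Ty n'} {σ σ' : Fin m → Tm n' m'}
    (hσ : SubstSim Γ Δ θ σ σ') :
    Sim Δ (e.subst θ σ) (e'.subst θ σ') (τ.subst θ) := by
  induction h generalizing n' m' with
  | var i => exact hσ _
  | prim o _ _ ih₁ ih₂ => rw [PrimOp.resTy_subst]; exact .prim o (ih₁ hσ) (ih₂ hσ)
  | caseOf _ _ _ ih ih₁ ih₂ =>
    exact .caseOf (ih hσ) (ih₁ (hσ.extend_subst _)) (ih₂ (hσ.extend_subst _))
  | lam _ ih => exact .lam (ih (hσ.extend_subst _))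
  | tlam _ ih => exact .tlam (ih hσ.extendTy_subst)
  | tapp τ₁ _ ih => rw [Ty.inst_subst]; exact .tapp _ (ih hσ)
  | pack _ ih =>
    refine .pack ?_
    rw [← Ty.inst_subst]
    exact ih hσ
  | unpack _ _ ih₁ ih₂ =>
    refine .unpack (ih₁ hσ) ?_
    rw [← Ty.rename_succ_subst_lift]
    exact ih₂ (hσ.extendTy_subst.extend_subst _)
  | fold _ ih =>
    refine .fold ?_
    have := ih hσ
    rwa [Ty.inst_subst] at this
  | unfold _ ih => rw [Ty.inst_subst]; exact .unfold (ih hσ)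
  | idCopy => rw [copyTm_subst]; exact .idCopy
  | copy _ ih =>
    rw [Tm.subst, copyTm_subst]
    exact .copy (ih hσ)
  | wrap _ ih =>
    rw [wrap_subst]
    exact .wrap (ih hσ)
  | unit => exact .unit
  | int k => exact .int k
  | tt => exact .tt
  | ff => exact .ff
  | cond _ _ _ ih ih₁ ih₂ => exact .cond (ih hσ) (ih₁ hσ) (ih₂ hσ)
  | pair _ _ ih₁ ih₂ => exact .pair (ih₁ hσ) (ih₂ hσ)
  | fst _ ih => exact .fst (ih hσ)
  | snd _ ih => exact .snd (ih hσ)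
  | inl _ ih => exact .inl (ih hσ)
  | inr _ ih => exact .inr (ih hσ)
  | app _ _ ih₁ ih₂ => exact .app (ih₁ hσ) (ih₂ hσ)

theorem Sim.instTm {n m : ℕ} {Γ : TCtx n m} {e e' : Tm n (m + 1)} {v v' : Tm n m} {τ₁ τ : Ty n}
    (h : Sim (Γ.extend τ₁) e e' τ) (hv : Sim Γ v v' τ₁) :
    Sim Γ (e.instTm v) (e'.instTm v') τ := by
  have := h.subst (Δ := Γ) (θ := Ty.var) (σ := Fin.cases v Tm.var) (σ' := Fin.cases v' Tm.var)
    fun i => by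
      rw [Ty.subst_var]
      cases i using Fin.cases with
      | zero => exact hv
      | succ i => exact .var i
  rwa [Ty.subst_var] at this

theorem Sim.instTy {n m : ℕ} {Γ : TCtx n m} {e e' : Tm (n + 1) m} {τ : Ty (n + 1)}
    (h : Sim Γ.extendTy e e' τ) (τ₁ : Ty n) :
    Sim Γ (e.instTy τ₁) (e'.instTy τ₁) (τ.inst τ₁) := by
  refine h.subst fun i => ?_
  simp only [TCtx.extendTy, Ty.rename_succ_subst, Ty.subst_var]
  exact .var i

theorem Sim.instTyTm {n m : ℕ} {Γ : TCtx n m} {e e' : Tm (n + 1) (m + 1)} {v v' : Tm n m}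
    {τ₁ τ : Ty n} {τ₂ : Ty (n + 1)}
    (h : Sim (Γ.extendTy.extend τ₂) e e' (τ.rename Fin.succ)) (hv : Sim Γ v v' (τ₂.inst τ₁)) :
    Sim Γ (e.instTyTm τ₁ v) (e'.instTyTm τ₁ v') τ := by
  have := h.subst (Δ := Γ) (θ := Fin.cases τ₁ Ty.var) (σ := Fin.cases v Tm.var)
    (σ' := Fin.cases v' Tm.var) fun i => by
      cases i using Fin.cases with
      | zero => exact hv
      | succ i =>
        simp only [TCtx.extend, TCtx.extendTy, Fin.cases_succ, Ty.rename_succ_subst, Ty.subst_var]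
        exact .var i
  rwa [Ty.rename_succ_subst, Ty.subst_var] at this

/-! ### Related values -/

section Canonical

-- Closed terms are those with `IsEmpty (Fin m)`: type variables play no role in evaluation.

variable {n m : ℕ} {Γ : TCtx n m} {v v' : Tm n m}

theorem Sim.canonical_int [IsEmpty (Fin m)] (h : Sim Γ v v' .int) (hv : IsValue v)
    (hv' : IsValue v') : ∃ k, v = .int k ∧ v' = .int k := by
  cases hv with
  | var i => exact isEmptyElim i
  | _ => cases h <;> simp

theorem Sim.canonical_bool [IsEmpty (Fin m)] (h : Sim Γ v v' .bool) (hv : IsValue v)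
    (hv' : IsValue v') : v = .tt ∧ v' = .tt ∨ v = .ff ∧ v' = .ff := by
  cases hv with
  | var i => exact isEmptyElim i
  | _ => cases h <;> simp

theorem Sim.canonical_unit [IsEmpty (Fin m)] (h : Sim Γ v v' .unit) (hv : IsValue v)
    (hv' : IsValue v') : v = .unit ∧ v' = .unit := by
  cases hv with
  | var i => exact isEmptyElim i
  | _ => cases h <;> simp

theorem Sim.canonical_prod [IsEmpty (Fin m)] {τ₁ τ₂ : Ty n} (h : Sim Γ v v' (.prod τ₁ τ₂))
    (hv : IsValue v) (hv' : IsValue v') :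
    ∃ v₁ v₂ v₁' v₂', v = .pair v₁ v₂ ∧ v' = .pair v₁' v₂' ∧ IsValue v₁ ∧ IsValue v₂ ∧
      IsValue v₁' ∧ IsValue v₂' ∧ Sim Γ v₁ v₁' τ₁ ∧ Sim Γ v₂ v₂' τ₂ := by
  cases hv with
  | var i => exact isEmptyElim i
  | pair h₁ h₂ =>
    cases h with
    | pair s₁ s₂ =>
      cases hv' with
      | pair h₁' h₂' => exact ⟨_, _, _, _, rfl, rfl, h₁, h₂, h₁', h₂', s₁, s₂⟩
  | _ => cases h

theorem Sim.canonical_sum [IsEmpty (Fin m)] {τ₁ τ₂ : Ty n} (h : Sim Γ v v' (.sum τ₁ τ₂))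
    (hv : IsValue v) (hv' : IsValue v') :
    (∃ w w', v = .inl (.sum τ₁ τ₂) w ∧ v' = .inl (.sum τ₁ τ₂) w' ∧ IsValue w ∧ IsValue w' ∧
      Sim Γ w w' τ₁) ∨
    ∃ w w', v = .inr (.sum τ₁ τ₂) w ∧ v' = .inr (.sum τ₁ τ₂) w' ∧ IsValue w ∧ IsValue w' ∧
      Sim Γ w w' τ₂ := by
  cases hv with
  | var i => exact isEmptyElim i
  | inl hw =>
    cases h with
    | inl s =>
      cases hv' with
      | inl hw' => exact .inl ⟨_, _, rfl, rfl, hw, hw', s⟩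
  | inr hw =>
    cases h with
    | inr s =>
      cases hv' with
      | inr hw' => exact .inr ⟨_, _, rfl, rfl, hw, hw', s⟩
  | _ => cases h

theorem Sim.canonical_arr [IsEmpty (Fin m)] {τ₁ τ₂ : Ty n} (h : Sim Γ v v' (.arr τ₁ τ₂))
    (hv : IsValue v) : ∃ e, v = .lam τ₁ e := by
  cases hv with
  | var i => exact isEmptyElim i
  | lam => cases h <;> exact ⟨_, rfl⟩
  | _ => cases h

theorem Sim.canonical_all [IsEmpty (Fin m)] {τ : Ty (n + 1)} (h : Sim Γ v v' (.all τ))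
    (hv : IsValue v) : ∃ e e', v = .tlam e ∧ v' = .tlam e' ∧ Sim Γ.extendTy e e' τ := by
  cases hv with
  | var i => exact isEmptyElim i
  | tlam =>
    cases h with
    | tlam s => exact ⟨_, _, rfl, rfl, s⟩
  | _ => cases h

theorem Sim.canonical_ex [IsEmpty (Fin m)] {τ : Ty (n + 1)} (h : Sim Γ v v' (.ex τ))
    (hv : IsValue v) (hv' : IsValue v') :
    ∃ τ₁ w w', v = .pack τ₁ w τ ∧ v' = .pack τ₁ w' τ ∧ IsValue w ∧ IsValue w' ∧
      Sim Γ w w' (τ.inst τ₁) := by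
  cases hv with
  | var i => exact isEmptyElim i
  | pack hw =>
    cases h with
    | pack s =>
      cases hv' with
      | pack hw' => exact ⟨_, _, _, rfl, rfl, hw, hw', s⟩
  | _ => cases h

theorem Sim.canonical_mu [IsEmpty (Fin m)] {τ : Ty (n + 1)} (h : Sim Γ v v' (.mu τ))
    (hv : IsValue v) (hv' : IsValue v') :
    ∃ w w', v = .fold (.mu τ) w ∧ v' = .fold (.mu τ) w' ∧ IsValue w ∧ IsValue w' ∧
      Sim Γ w w' (τ.inst (.mu τ)) := by
  cases hv with
  | var i => exact isEmptyElim i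
  | fold hw =>
    cases h with
    | fold s =>
      cases hv' with
      | fold hw' => exact ⟨_, _, rfl, rfl, hw, hw', s⟩
    | copy s => cases hv'
  | _ => cases h; cases hv'

/-- Every term related to an abstraction at a function type is an abstraction. -/
theorem Sim.isValue_of_lam {τ τ₁ τ₂ : Ty n} {e : Tm n (m + 1)} {g : Tm n m}
    (h : Sim Γ (.lam τ e) g (.arr τ₁ τ₂)) : IsValue g := by
  cases h
  · exact .lam _ _
  · exact copyTm_isValue _ _
  · exact wrap_isValue _

/-- Copying a value related to `v` yields a value that is still related to `v`: on an injected
function the copy only adds a wrapper. -/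
theorem Sim.copy_value [IsEmpty (Fin m)] (h : Sim Γ v v' (recTyIn n)) (hv : IsValue v)
    (hv' : IsValue v') :
    ∃ w, RedPlus (.app (copyTm n m) v') w ∧ IsValue w ∧ Sim Γ v w (recTyIn n) := by
  obtain ⟨u, u', rfl, rfl, hu, hu', s⟩ := h.canonical_mu hv hv'
  rw [recTyIn_inst] at s
  obtain ⟨w, w', rfl, rfl, hw, hw', s⟩ | ⟨w, w', rfl, rfl, hw, hw', s⟩ := s.canonical_sum hu hu'
  · obtain ⟨rfl, rfl⟩ := s.canonical_unit hw hw'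
    exact ⟨_, copyTm_app_inl, .fold (.inl .unit), h⟩
  · obtain ⟨e, rfl⟩ := s.canonical_arr hw
    exact ⟨_, copyTm_app_inr hw', .fold (.inr (wrap_isValue _)), .fold (.inr s.wrap)⟩

end Canonical

theorem Reds.map {n m : ℕ} {e e' : Tm n m} (h : Reds e e') (f : Tm n m → Tm n m)
    (hf : ∀ {a b}, Red a b → Red (f a) (f b)) : Reds (f e) (f e') :=
  Relation.ReflTransGen.lift f (fun _ _ => hf) _ _ h

theorem RedPlus.map {n m : ℕ} {e e' : Tm n m} (h : RedPlus e e') (f : Tm n m → Tm n m)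
    (hf : ∀ {a b}, Red a b → Red (f a) (f b)) : RedPlus (f e) (f e') :=
  Relation.TransGen.lift f (fun _ _ => hf) _ _ h

/-- A term related to a closed value evaluates to a related value: the only work left in it is to
run copy functions applied to values. -/
theorem Sim.value {n m : ℕ} [hm : IsEmpty (Fin m)] {Γ : TCtx n m} {v e' : Tm n m} {τ : Ty n}
    (h : Sim Γ v e' τ) (hv : IsValue v) : ∃ v', Reds e' v' ∧ IsValue v' ∧ Sim Γ v v' τ := by
  induction h generalizing hm with
  | var i => exact isEmptyElim i
  | unit => exact ⟨_, .refl, hv, .unit⟩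
  | int k => exact ⟨_, .refl, hv, .int k⟩
  | tt => exact ⟨_, .refl, hv, .tt⟩
  | ff => exact ⟨_, .refl, hv, .ff⟩
  | pair s₁ s₂ ih₁ ih₂ =>
    cases hv with
    | pair h₁ h₂ =>
      obtain ⟨v₁, r₁, hv₁, t₁⟩ := ih₁ h₁
      obtain ⟨v₂, r₂, hv₂, t₂⟩ := ih₂ h₂
      exact ⟨_, (r₁.map (Tm.pair · _) .pairL).trans
        (r₂.map (Tm.pair v₁) (.pairR hv₁)), .pair hv₁ hv₂, .pair t₁ t₂⟩
  | inl _ ih =>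
    cases hv with
    | inl hv =>
      obtain ⟨w, r, hw, t⟩ := ih hv
      exact ⟨_, r.map (Tm.inl _) .inlC, .inl hw, .inl t⟩
  | inr _ ih =>
    cases hv with
    | inr hv =>
      obtain ⟨w, r, hw, t⟩ := ih hv
      exact ⟨_, r.map (Tm.inr _) .inrC, .inr hw, .inr t⟩
  | lam s => exact ⟨_, .refl, .lam _ _, .lam s⟩
  | tlam s => exact ⟨_, .refl, .tlam _, .tlam s⟩
  | pack _ ih =>
    cases hv with
    | pack hv =>
      obtain ⟨w, r, hw, t⟩ := ih hv
      exact ⟨_, r.map (Tm.pack _ · _) .packC, .pack hw, .pack t⟩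
  | fold _ ih =>
    cases hv with
    | fold hv =>
      obtain ⟨w, r, hw, t⟩ := ih hv
      exact ⟨_, r.map (Tm.fold _) .foldC, .fold hw, .fold t⟩
  | idCopy => exact ⟨_, .refl, copyTm_isValue _ _, .idCopy⟩
  | copy _ ih =>
    obtain ⟨w, r, hw, t⟩ := ih hv
    obtain ⟨u, r', hu, t'⟩ := t.copy_value hv hw
    exact ⟨u, (r.map (Tm.app _) (.appR (copyTm_isValue _ _))).trans r'.to_reflTransGen, hu, t'⟩
  | wrap s => exact ⟨_, .refl, wrap_isValue _, .wrap s⟩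
  | _ => cases hv

/-- Related functions, applied to related values, reduce to related terms. Wrapped functions are
unwrapped by induction on the derivation: `λ y. copy (g (copy y))` copies its argument, calls `g`,
and leaves a copy function around the result. -/
theorem Sim.beta {n m : ℕ} [hm : IsEmpty (Fin m)] {Γ : TCtx n m} {τ τ₁ τ₂ : Ty n}
    {e : Tm n (m + 1)} {g v v' : Tm n m} (h : Sim Γ (.lam τ e) g (.arr τ₁ τ₂))
    (hv : IsValue v) (hv' : IsValue v') (s : Sim Γ v v' τ₁) :
    ∃ r, RedPlus (.app g v') r ∧ Sim Γ (e.instTm v) r τ₂ := by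
  generalize hl : Tm.lam τ e = l at h
  generalize ha : Ty.arr τ₁ τ₂ = a at h
  induction h generalizing hm with
  | lam t =>
    cases hl
    cases ha
    exact ⟨_, .single (.beta hv'), t.instTm s⟩
  | idCopy =>
    cases hl
    cases ha
    obtain ⟨w, r, -, t⟩ := s.copy_value hv hv'
    exact ⟨w, r, t⟩
  | copy => cases ha
  | @wrap _ _ _ _ g t ih =>
    cases hl
    cases ha
    obtain ⟨w, r, hw, s'⟩ := s.copy_value hv hv'
    obtain ⟨u, r', t'⟩ := ih hv hw s' rfl rfl
    have hg := t.isValue_of_lam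
    have hb : Red (.app (FMu.wrap g) v')
        (.app (copyTm _ _) (.app g (.app (copyTm _ _) v'))) := by
      have : Red (.app (FMu.wrap g) v') _ := .beta hv'
      simpa [FMu.wrap, Tm.instTm, Tm.subst] using this
    have hr := (r.map (Tm.app _) (.appR hg)).trans r'
    exact ⟨_, .head hb (RedPlus.map hr (Tm.app _) (.appR (copyTm_isValue _ _))), t'.copy⟩
  | _ => cases hl

theorem _root_.Relation.ReflTransGen.trans_transGen {α : Type*} {r : α → α → Prop} {a b c : α}
    (h : Relation.ReflTransGen r a b) (h' : Relation.TransGen r b c) : Relation.TransGen r a c :=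
  .trans_right h h'

/-! ### The simulation and its consequences for termination -/

theorem PrimOp.eval_sim {n m : ℕ} (Γ : TCtx n m) (o : PrimOp) (a b : ℤ) :
    Sim Γ (o.eval a b) (o.eval a b) o.resTy := by
  cases o
  case add | sub | mul => exact .int _
  all_goals
    simp only [PrimOp.eval]
    split
    · exact .tt
    · exact .ff

/-- A step of the left term is matched by at least one step of the right term. -/
theorem Sim.red {n m : ℕ} [hm : IsEmpty (Fin m)] {Γ : TCtx n m} {e e₁ e' : Tm n m} {τ : Ty n}
    (h : Sim Γ e e' τ) (r : Red e e₁) : ∃ e₁', RedPlus e' e₁' ∧ Sim Γ e₁ e₁' τ := by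
  induction h generalizing hm with
  | var i => exact isEmptyElim i
  | unit | int | tt | ff | lam | tlam | idCopy | wrap => cases r
  | prim o s₁ s₂ ih₁ ih₂ =>
    cases r with
    | prim _ a b =>
      obtain ⟨v₁, r₁, hv₁, t₁⟩ := s₁.value (.int a)
      obtain ⟨v₂, r₂, hv₂, t₂⟩ := s₂.value (.int b)
      cases t₁
      cases t₂
      exact ⟨_, ((r₁.map (Tm.prim o · _) .primL).trans
        (r₂.map (Tm.prim o _) (.primR hv₁))).trans_transGen (.single (.prim o a b)),
        PrimOp.eval_sim _ o a b⟩
    | primL r =>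
      obtain ⟨u, r', t⟩ := ih₁ r
      exact ⟨_, r'.map (Tm.prim o · _) .primL, .prim o t s₂⟩
    | primR hv r =>
      obtain ⟨v₁, r₁, hv₁, t₁⟩ := s₁.value hv
      obtain ⟨u, r', t⟩ := ih₂ r
      exact ⟨_, (r₁.map (Tm.prim o · _) .primL).trans_transGen
        (r'.map (Tm.prim o _) (.primR hv₁)), .prim o t₁ t⟩
  | cond s s₁ s₂ ih =>
    cases r with
    | condTrue =>
      obtain ⟨v, r, hv, t⟩ := s.value .tt
      cases t
      exact ⟨_, (r.map (Tm.cond · _ _) .condC).trans_transGen (.single (.condTrue _ _)), s₁⟩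
    | condFalse =>
      obtain ⟨v, r, hv, t⟩ := s.value .ff
      cases t
      exact ⟨_, (r.map (Tm.cond · _ _) .condC).trans_transGen (.single (.condFalse _ _)), s₂⟩
    | condC r =>
      obtain ⟨u, r', t⟩ := ih r
      exact ⟨_, r'.map (Tm.cond · _ _) .condC, .cond t s₁ s₂⟩
  | pair s₁ s₂ ih₁ ih₂ =>
    cases r with
    | pairL r =>
      obtain ⟨u, r', t⟩ := ih₁ r
      exact ⟨_, r'.map (Tm.pair · _) .pairL, .pair t s₂⟩
    | pairR hv r =>
      obtain ⟨v₁, r₁, hv₁, t₁⟩ := s₁.value hv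
      obtain ⟨u, r', t⟩ := ih₂ r
      exact ⟨_, (r₁.map (Tm.pair · _) .pairL).trans_transGen (r'.map (Tm.pair _) (.pairR hv₁)),
        .pair t₁ t⟩
  | fst s ih =>
    cases r with
    | fst h₁ h₂ =>
      obtain ⟨v, r, hv, t⟩ := s.value (.pair h₁ h₂)
      obtain ⟨_, _, _, _, ⟨⟩, rfl, -, -, h₁', h₂', t₁, -⟩ := t.canonical_prod (.pair h₁ h₂) hv
      exact ⟨_, (r.map Tm.fst .fstC).trans_transGen (.single (.fst h₁' h₂')), t₁⟩
    | fstC r =>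
      obtain ⟨u, r', t⟩ := ih r
      exact ⟨_, r'.map Tm.fst .fstC, .fst t⟩
  | snd s ih =>
    cases r with
    | snd h₁ h₂ =>
      obtain ⟨v, r, hv, t⟩ := s.value (.pair h₁ h₂)
      obtain ⟨_, _, _, _, ⟨⟩, rfl, -, -, h₁', h₂', -, t₂⟩ := t.canonical_prod (.pair h₁ h₂) hv
      exact ⟨_, (r.map Tm.snd .sndC).trans_transGen (.single (.snd h₁' h₂')), t₂⟩
    | sndC r =>
      obtain ⟨u, r', t⟩ := ih r
      exact ⟨_, r'.map Tm.snd .sndC, .snd t⟩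
  | inl _ ih =>
    cases r with
    | inlC r =>
      obtain ⟨u, r', t⟩ := ih r
      exact ⟨_, r'.map (Tm.inl _) .inlC, .inl t⟩
  | inr _ ih =>
    cases r with
    | inrC r =>
      obtain ⟨u, r', t⟩ := ih r
      exact ⟨_, r'.map (Tm.inr _) .inrC, .inr t⟩
  | caseOf s s₁ s₂ ih =>
    cases r with
    | caseInl h =>
      obtain ⟨v, r, hv, t⟩ := s.value (.inl h)
      obtain ⟨_, _, ⟨⟩, rfl, -, h', t⟩ | ⟨_, _, ⟨⟩, -⟩ := t.canonical_sum (.inl h) hv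
      exact ⟨_, (r.map (Tm.caseOf · _ _) .caseC).trans_transGen (.single (.caseInl h')),
        s₁.instTm t⟩
    | caseInr h =>
      obtain ⟨v, r, hv, t⟩ := s.value (.inr h)
      obtain ⟨_, _, ⟨⟩, -⟩ | ⟨_, _, ⟨⟩, rfl, -, h', t⟩ := t.canonical_sum (.inr h) hv
      exact ⟨_, (r.map (Tm.caseOf · _ _) .caseC).trans_transGen (.single (.caseInr h')),
        s₂.instTm t⟩
    | caseC r =>
      obtain ⟨u, r', t⟩ := ih r
      exact ⟨_, r'.map (Tm.caseOf · _ _) .caseC, .caseOf t s₁ s₂⟩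
  | app s₁ s₂ ih₁ ih₂ =>
    cases r with
    | beta hv =>
      obtain ⟨g, r₁, hg, t₁⟩ := s₁.value (.lam _ _)
      obtain ⟨v', r₂, hv', t₂⟩ := s₂.value hv
      obtain ⟨u, r, t⟩ := t₁.beta hv hv' t₂
      exact ⟨u, ((r₁.map (Tm.app · _) .appL).trans (r₂.map (Tm.app _) (.appR hg))).trans_transGen r,
        t⟩
    | appL r =>
      obtain ⟨u, r', t⟩ := ih₁ r
      exact ⟨_, r'.map (Tm.app · _) .appL, .app t s₂⟩
    | appR hv r =>
      obtain ⟨g, r₁, hg, t₁⟩ := s₁.value hv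
      obtain ⟨u, r', t⟩ := ih₂ r
      exact ⟨_, (r₁.map (Tm.app · _) .appL).trans_transGen (r'.map (Tm.app _) (.appR hg)),
        .app t₁ t⟩
  | tapp τ s ih =>
    cases r with
    | tbeta =>
      obtain ⟨v, r, hv, t⟩ := s.value (.tlam _)
      obtain ⟨_, _, ⟨⟩, rfl, t₁⟩ := t.canonical_all (.tlam _)
      exact ⟨_, (r.map (Tm.tapp · _) .tappC).trans_transGen (.single (.tbeta _ _)), t₁.instTy τ⟩
    | tappC r =>
      obtain ⟨u, r', t⟩ := ih r
      exact ⟨_, r'.map (Tm.tapp · _) .tappC, .tapp _ t⟩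
  | pack _ ih =>
    cases r with
    | packC r =>
      obtain ⟨u, r', t⟩ := ih r
      exact ⟨_, r'.map (Tm.pack _ · _) .packC, .pack t⟩
  | unpack s₁ s₂ ih =>
    cases r with
    | unpack h =>
      obtain ⟨v, r, hv, t⟩ := s₁.value (.pack h)
      obtain ⟨_, _, _, ⟨⟩, rfl, -, h', t⟩ := t.canonical_ex (.pack h) hv
      exact ⟨_, (r.map (Tm.unpack · _) .unpackC).trans_transGen (.single (.unpack h')),
        s₂.instTyTm t⟩
    | unpackC r =>
      obtain ⟨u, r', t⟩ := ih r
      exact ⟨_, r'.map (Tm.unpack · _) .unpackC, .unpack t s₂⟩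
  | fold _ ih =>
    cases r with
    | foldC r =>
      obtain ⟨u, r', t⟩ := ih r
      exact ⟨_, r'.map (Tm.fold _) .foldC, .fold t⟩
  | unfold s ih =>
    cases r with
    | unfold h =>
      obtain ⟨v, r, hv, t⟩ := s.value (.fold h)
      obtain ⟨_, _, ⟨⟩, rfl, -, h', t⟩ := t.canonical_mu (.fold h) hv
      exact ⟨_, (r.map Tm.unfold .unfoldC).trans_transGen (.single (.unfold h')), t⟩
    | unfoldC r =>
      obtain ⟨u, r', t⟩ := ih r
      exact ⟨_, r'.map Tm.unfold .unfoldC, .unfold t⟩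
  | copy _ ih =>
    obtain ⟨u, r', t⟩ := ih r
    exact ⟨_, r'.map (Tm.app _) (.appR (copyTm_isValue _ _)), .copy t⟩

/-- As `Sim` contains the typing of its left term, that term cannot get stuck. -/
theorem Sim.progress {n m : ℕ} [hm : IsEmpty (Fin m)] {Γ : TCtx n m} {e e' : Tm n m} {τ : Ty n}
    (h : Sim Γ e e' τ) : IsValue e ∨ ∃ e₁, Red e e₁ := by
  induction h generalizing hm with
  | var i => exact isEmptyElim i
  | unit => exact .inl .unit
  | int k => exact .inl (.int k)
  | tt => exact .inl .tt
  | ff => exact .inl .ff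
  | lam | idCopy | wrap => exact .inl (.lam _ _)
  | tlam => exact .inl (.tlam _)
  | copy _ ih => exact ih
  | prim o s₁ s₂ ih₁ ih₂ =>
    obtain hv | ⟨u, r⟩ := ih₁
    · obtain hw | ⟨u, r⟩ := ih₂
      · obtain ⟨_, -, hv', t₁⟩ := s₁.value hv
        obtain ⟨_, -, hw', t₂⟩ := s₂.value hw
        obtain ⟨a, rfl, -⟩ := t₁.canonical_int hv hv'
        obtain ⟨b, rfl, -⟩ := t₂.canonical_int hw hw'
        exact .inr ⟨_, .prim o a b⟩
      · exact .inr ⟨_, .primR hv r⟩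
    · exact .inr ⟨_, .primL r⟩
  | cond s _ _ ih =>
    obtain hv | ⟨u, r⟩ := ih
    · obtain ⟨_, -, hv', t⟩ := s.value hv
      obtain ⟨rfl, -⟩ | ⟨rfl, -⟩ := t.canonical_bool hv hv'
      · exact .inr ⟨_, .condTrue _ _⟩
      · exact .inr ⟨_, .condFalse _ _⟩
    · exact .inr ⟨_, .condC r⟩
  | pair _ _ ih₁ ih₂ =>
    obtain hv | ⟨u, r⟩ := ih₁
    · obtain hw | ⟨u, r⟩ := ih₂
      · exact .inl (.pair hv hw)
      · exact .inr ⟨_, .pairR hv r⟩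
    · exact .inr ⟨_, .pairL r⟩
  | fst s ih =>
    obtain hv | ⟨u, r⟩ := ih
    · obtain ⟨_, -, hv', t⟩ := s.value hv
      obtain ⟨_, _, _, _, rfl, -, h₁, h₂, -⟩ := t.canonical_prod hv hv'
      exact .inr ⟨_, .fst h₁ h₂⟩
    · exact .inr ⟨_, .fstC r⟩
  | snd s ih =>
    obtain hv | ⟨u, r⟩ := ih
    · obtain ⟨_, -, hv', t⟩ := s.value hv
      obtain ⟨_, _, _, _, rfl, -, h₁, h₂, -⟩ := t.canonical_prod hv hv'
      exact .inr ⟨_, .snd h₁ h₂⟩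
    · exact .inr ⟨_, .sndC r⟩
  | inl _ ih => exact ih.imp .inl fun ⟨_, r⟩ => ⟨_, .inlC r⟩
  | inr _ ih => exact ih.imp .inr fun ⟨_, r⟩ => ⟨_, .inrC r⟩
  | caseOf s _ _ ih =>
    obtain hv | ⟨u, r⟩ := ih
    · obtain ⟨_, -, hv', t⟩ := s.value hv
      obtain ⟨_, _, rfl, -, h, -⟩ | ⟨_, _, rfl, -, h, -⟩ := t.canonical_sum hv hv'
      · exact .inr ⟨_, .caseInl h⟩
      · exact .inr ⟨_, .caseInr h⟩
    · exact .inr ⟨_, .caseC r⟩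
  | app s₁ _ ih₁ ih₂ =>
    obtain hv | ⟨u, r⟩ := ih₁
    · obtain hw | ⟨u, r⟩ := ih₂
      · obtain ⟨_, rfl⟩ := s₁.canonical_arr hv
        exact .inr ⟨_, .beta hw⟩
      · exact .inr ⟨_, .appR hv r⟩
    · exact .inr ⟨_, .appL r⟩
  | tapp _ s ih =>
    obtain hv | ⟨u, r⟩ := ih
    · obtain ⟨_, _, rfl, -⟩ := s.canonical_all hv
      exact .inr ⟨_, .tbeta _ _⟩
    · exact .inr ⟨_, .tappC r⟩
  | pack _ ih => exact ih.imp .pack fun ⟨_, r⟩ => ⟨_, .packC r⟩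
  | unpack s _ ih =>
    obtain hv | ⟨u, r⟩ := ih
    · obtain ⟨_, -, hv', t⟩ := s.value hv
      obtain ⟨_, _, _, rfl, -, h, -⟩ := t.canonical_ex hv hv'
      exact .inr ⟨_, .unpack h⟩
    · exact .inr ⟨_, .unpackC r⟩
  | fold _ ih => exact ih.imp .fold fun ⟨_, r⟩ => ⟨_, .foldC r⟩
  | unfold s ih =>
    obtain hv | ⟨u, r⟩ := ih
    · obtain ⟨_, -, hv', t⟩ := s.value hv
      obtain ⟨_, _, rfl, -, h, -⟩ := t.canonical_mu hv hv'
      exact .inr ⟨_, .unfold h⟩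
    · exact .inr ⟨_, .unfoldC r⟩

theorem Sim.terminates {n m : ℕ} [IsEmpty (Fin m)] {Γ : TCtx n m} {e e' : Tm n m} {τ : Ty n}
    (h : Sim Γ e e' τ) (ht : Terminates e) : Terminates e' := by
  rw [terminates_iff] at ht ⊢
  obtain ⟨v, r, hv⟩ := ht
  induction r using Relation.ReflTransGen.head_induction_on generalizing e' with
  | refl =>
    obtain ⟨v', r, hv', -⟩ := h.value hv
    exact ⟨v', r, hv'⟩
  | head r _ ih =>
    obtain ⟨u, r', t⟩ := h.red r
    obtain ⟨w, rw, hw⟩ := ih t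
    exact ⟨w, r'.to_reflTransGen.trans rw, hw⟩

/-- Every step on the left costs at least one step on the right, so a left term that is related to
a terminating term has no infinite reduction; by progress it reaches a value. -/
theorem Sim.terminates_symm {n m : ℕ} [IsEmpty (Fin m)] {Γ : TCtx n m} {e e' : Tm n m}
    {τ : Ty n} (h : Sim Γ e e' τ) (ht : Terminates e') : Terminates e := by
  rw [terminates_iff] at ht ⊢
  obtain ⟨v', hr, hv'⟩ := ht
  -- Reduction steps ending in the value `v'` form a well-founded relation.
  have acc : Acc (fun a b => RedPlus b a) e' := by
    clear h
    rw [show (fun a b : Tm n m => RedPlus b a) = Relation.TransGen (fun a b => Red b a) by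
      funext a b
      exact propext Relation.transGen_swap]
    refine Acc.transGen ?_
    induction hr using Relation.ReflTransGen.head_induction_on with
    | refl => exact ⟨_, fun u r => (hv'.not_red r).elim⟩
    | head r _ ih => exact ⟨_, fun u r' => r.deterministic r' ▸ ih⟩
  clear hr
  -- Each step of `e` moves strictly along this relation on the right.
  induction acc generalizing e with
  | intro e' _ ih =>
    obtain hv | ⟨u, r⟩ := h.progress
    · exact ⟨e, .refl, hv⟩
    · obtain ⟨u', r', t⟩ := h.red r
      obtain ⟨w, hr, hw⟩ := ih u' r' t
      exact ⟨w, .head r hr, hw⟩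

/-! ### The identity and the copy function -/

theorem idFun_hasType : HasType TCtx.empty idFun (.arr recTy recTy) :=
  .lam (.var 0)

theorem unrollFun_hasType {n m : ℕ} {Γ : TCtx n m} {τ₁ τ₂ : Ty n} {w : Tm n m}
    (h : HasType (Γ.extend τ₁) (w.rename id Fin.succ) (fixTy τ₁ τ₂)) :
    HasType Γ (unrollFun τ₁ w) (.arr τ₁ τ₂) := by
  have hu : HasType (Γ.extend τ₁) (.unfold (w.rename id Fin.succ))
      (.arr (fixTy τ₁ τ₂) (.arr τ₁ τ₂)) := by
    have := HasType.unfold h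
    simpa [Ty.inst, Ty.subst, Ty.rename, Ty.rename_succ_subst, fixTy] using this
  exact .lam (.app (.app hu h) (.var 0))

theorem copyFun_hasType : HasType TCtx.empty copyFun (.arr recTy recTy) := by
  refine unrollFun_hasType ?_
  -- The weakened self-application argument has again the normal form `copySelf`.
  change HasType _ (copySelf 0 1) (fixTy recTy recTy)
  refine .fold (.lam (.app (.lam (.lam ?_)) (unrollFun_hasType (.var 1))))
  refine .caseOf (τ₁ := .unit) (τ₂ := .arr recTy recTy)
    (HasType.unfold (τ := .sum .unit (.arr (.var 0) (.var 0))) (.var 0)) ?_ ?_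
  · exact .fold (.inl .unit)
  · exact .fold (.inr (.lam (.app (.var 3) (.app (.var 1) (.app (.var 3) (.var 0))))))

end FMu

theorem mainTheorem11 :
    FMu.CtxEquiv FMu.TCtx.empty FMu.idFun FMu.copyFun (FMu.Ty.arr FMu.recTy FMu.recTy) := by
  refine ⟨⟨FMu.idFun_hasType, FMu.copyFun_hasType, fun C τ' hC => ?_⟩,
    ⟨FMu.copyFun_hasType, FMu.idFun_hasType, fun C τ' hC => ?_⟩⟩
  · exact hC.sim.terminates
  · exact hC.sim.terminates_symm
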